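/- Let $\mathcal H=L^2(\mathbb R^3)$ (complex-valued functions, inner product $(\cdot,\cdot)$ linear in the second argument), let $\mathbf p=-i\nabla$ (distributional derivative) and $\mathbf x$ (multiplication by the coordinates) be the componentwise momentum and position operators on their maximal domains in $\mathcal H$, and let $q_0(\varphi,\psi)=\tfrac12(\mathbf p\varphi,\mathbf p\psi)+\tfrac12(\mathbf x\varphi,\mathbf x\psi)$ with form domain $D(q_0)=D(\mathbf p)\cap D(\mathbf x)$. Let $h_0=\tfrac12(\mathbf p^2+\mathbf x^2)$ be the operator determined by $q_0$: $\psi\in D(h_0)$ with $h_0\psi=\chi$ if and only if $\psi\in D(q_0)$, $\chi\in\mathcal H$ and $q_0(\varphi,\psi)=(\varphi,\chi)$ for all $\varphi\in D(q_0)$. Let $\mathbf a\in L^\infty(\mathbb R^3;\mathbb R^3)$ and $v\in L^\infty(\mathbb R^3;\mathbb R)$, put $\boldsymbol\pi=\mathbf p-\mathbf a$, and define on $D(q)=D(q_0)$ the form $$q(\varphi,\psi)=\tfrac12(\boldsymbol\pi\varphi,\boldsymbol\pi\psi)+\tfrac12(\mathbf x\varphi,\mathbf x\psi)+(\varphi,v\psi).$$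 Then $q$ is a densely defined Hermitian form which is bounded below and closed. There is a unique self-adjoint operator $h$ corresponding to $q$, in the sense that $D(h)\subseteq D(q)$ and $q(\varphi,\psi)=(\varphi,h\psi)$ for all $\varphi\in D(q)$, $\psi\in D(h)$; namely, $h$ is the operator determined by $q$ in the same way as $h_0$ is determined by $q_0$. The space $C_0^\infty(\mathbb R^3)$ is a form core: it is contained in $D(q)$ and dense in it with respect to the form norm. For every real $\alpha>\|v\|_\infty$ the operator $h+\alpha\mathbb 1$ is positive (that is, $(\psi,(h+\alpha\mathbb 1)\psi)>0$ for all nonzero $\psi\in D(h)$), it has a unique positive self-adjoint square root, and $D((h+\alpha\mathbb 1)^{1/2})=D(q_0)$. If, in addition, the distributional divergence $\nabla\cdot\mathbf a$ belongs to $L^\infty(\mathbb R^3)$, then $D(h)=D(h_0)$, and $h$ is essentially self-adjoint on $C_0^\infty(\mathbb R^3)$ (that is, $C_0^\infty(\mathbb R^3)\subseteq D(h)$ and the closure of the restriction of $h$ to $C_0^\infty(\mathbb R^3)$ is self-adjoint). -/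

import Mathlib

open MeasureTheory Filter Topology
open scoped ENNReal ContDiff

noncomputable section

namespace MagneticOscillator

/-! ### Sesquilinear forms and operators in a Hilbert space -/

section Abstract

variable {H : Type*} [NormedAddCommGroup H] [InnerProductSpace ℂ H]

/-- A sesquilinear form on a subspace (the form domain) of a complex inner product space,
conjugate-linear in the first argument and linear in the second. -/
structure SesqForm (H : Type*) [NormedAddCommGroup H] [InnerProductSpace ℂ H] where
  /-- the form domain -/
  domain : Submodule ℂ H
  /-- the form `q(φ, ψ)` -/
  form : domain →ₗ⋆[ℂ] domain →ₗ[ℂ] ℂ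

namespace SesqForm

/-- `q(φ, ψ)` is the complex conjugate of `q(ψ, φ)`. -/
def IsHermitian (q : SesqForm H) : Prop :=
  ∀ φ ψ : q.domain, q.form φ ψ = star (q.form ψ φ)

/-- `q(φ, φ) ≥ m ‖φ‖²` for some real `m`. -/
def IsBoundedBelow (q : SesqForm H) : Prop :=
  ∃ m : ℝ, ∀ φ : q.domain, m * ‖(φ : H)‖ ^ 2 ≤ (q.form φ φ).re

/-- Closedness of a (semibounded) form: if `u n` lies in the form domain, `u n → ψ` in norm and
`q(u m - u n, u m - u n) → 0` as `m, n → ∞`, then `ψ` is in the form domain and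
`q(u n - ψ, u n - ψ) → 0`. -/
def IsClosed (q : SesqForm H) : Prop :=
  ∀ (u : ℕ → q.domain) (ψ : H),
    Tendsto (fun n => (u n : H)) atTop (𝓝 ψ) →
    (∀ ε > 0, ∃ N, ∀ m ≥ N, ∀ n ≥ N, ‖q.form (u m - u n) (u m - u n)‖ < ε) →
    ∃ φ : q.domain, (φ : H) = ψ ∧
      Tendsto (fun n => q.form (u n - φ) (u n - φ)) atTop (𝓝 0)

/-- `C` is a form core of the (semibounded) form `q`: it is contained in the form domain and dense
in it with respect to the form norm. -/
def IsFormCore (q : SesqForm H) (C : Submodule ℂ H) : Prop :=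
  C ≤ q.domain ∧ ∀ φ : q.domain, ∃ u : ℕ → q.domain,
    (∀ n, (u n : H) ∈ C) ∧ Tendsto (fun n => (u n : H)) atTop (𝓝 (φ : H)) ∧
      Tendsto (fun n => q.form (u n - φ) (u n - φ)) atTop (𝓝 0)

/-- The operator `T` corresponds to the form `q`: its domain lies in the form domain and
`q(φ, ψ) = ⟪φ, T ψ⟫` for all `φ` in the form domain and `ψ` in the domain of `T`. -/
def Represents (q : SesqForm H) (T : H →ₗ.[ℂ] H) : Prop :=
  ∃ hT : T.domain ≤ q.domain, ∀ (φ : q.domain) (ψ : T.domain),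
    q.form φ (Submodule.inclusion hT ψ) = inner ℂ (φ : H) (T ψ)

/-- The graph of the operator determined by `q`: the pairs `(ψ, χ)` with `ψ` in the form domain and
`q(φ, ψ) = ⟪φ, χ⟫` for all `φ` in the form domain. -/
def operatorGraph (q : SesqForm H) : Submodule ℂ (H × H) where
  carrier := {z | ∃ ψ : q.domain, (ψ : H) = z.1 ∧
    ∀ φ : q.domain, q.form φ ψ = inner ℂ (φ : H) z.2}
  zero_mem' := ⟨0, by simp, by simp⟩
  add_mem' := by
    rintro z w ⟨ψ, hψ, h⟩ ⟨ψ', hψ', h'⟩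
    exact ⟨ψ + ψ', by simp [hψ, hψ'], fun φ => by simp [h, h']⟩
  smul_mem' := by
    rintro c z ⟨ψ, hψ, h⟩
    exact ⟨c • ψ, by simp [hψ], fun φ => by simp [h]⟩

/-- The operator determined by `q`. (The graph is single-valued as soon as the form domain is
dense.) -/
def operator (q : SesqForm H) : H →ₗ.[ℂ] H := q.operatorGraph.toLinearPMap

theorem operatorGraph_single_valued (q : SesqForm H) (hq : Dense (q.domain : Set H)) :
    ∀ z ∈ q.operatorGraph, z.1 = 0 → z.2 = 0 := by
  rintro z ⟨ψ, hψ, h⟩ hz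
  have h0 : ψ = 0 := Subtype.ext (by simp [hψ, hz])
  subst h0
  refine hq.eq_zero_of_inner_right ℂ fun φ hφ => ?_
  simpa using (h ⟨φ, hφ⟩).symm

end SesqForm

/-- The operator `T + c`, with the domain of `T`. -/
def shift (T : H →ₗ.[ℂ] H) (c : ℝ) : H →ₗ.[ℂ] H :=
  ((c : ℂ) • (LinearMap.id : H →ₗ[ℂ] H)) +ᵥ T

variable [CompleteSpace H]

/-- `S` is a positive square root of `A`: `S` is self-adjoint, `⟪ψ, S ψ⟫ ≥ 0` on its domain, and
`S ∘ S = A` including equality of domains, where `S ∘ S` is defined on those `ψ` in the domain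
of `S` for which `S ψ` is in the domain of `S` again. -/
def IsPositiveSqrt (S A : H →ₗ.[ℂ] H) : Prop :=
  IsSelfAdjoint S ∧ (∀ ψ : S.domain, 0 ≤ (inner ℂ (ψ : H) (S ψ)).re) ∧
    ∀ ψ χ : H, (ψ, χ) ∈ A.graph ↔ ∃ η : H, (ψ, η) ∈ S.graph ∧ (η, χ) ∈ S.graph

/-- `T` is essentially self-adjoint on `C`: `C` is contained in the domain of `T`, and the
restriction of `T` to `C` has a self-adjoint closure. -/
def IsEssentiallySelfAdjointOn (T : H →ₗ.[ℂ] H) (C : Submodule ℂ H) : Prop :=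
  C ≤ T.domain ∧ (T.domRestrict C).IsClosable ∧ IsSelfAdjoint (T.domRestrict C).closure

end Abstract

/-! ### The concrete operators and forms in `L²(ℝ³)` -/

/-- The Euclidean space `ℝ³`. -/
abbrev E3 := EuclideanSpace ℝ (Fin 3)

/-- The Hilbert space `L²(ℝ³)` of complex-valued functions. -/
abbrev L2 := Lp ℂ 2 (volume : Measure E3)

/-- The space `L^∞(ℝ³)` of real-valued functions; its norm is the essential supremum norm. -/
abbrev LInf := Lp ℝ ∞ (volume : Measure E3)

/-- The partial derivative `∂ⱼ g` of a real function on `ℝ³`. -/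
def partialDeriv (j : Fin 3) (g : E3 → ℝ) (x : E3) : ℝ :=
  fderiv ℝ g x (EuclideanSpace.single j 1)

theorem integrable_smul_L2 {g : E3 → ℝ} (hg : Continuous g) (hg' : HasCompactSupport g)
    (ψ : L2) : Integrable (fun x => g x • ψ x) :=
  memLp_one_iff_integrable.1 ((Lp.memLp ψ).smul (hg.memLp_of_hasCompactSupport hg') (p := 2))

theorem continuous_partialDeriv {g : E3 → ℝ} (hg : ContDiff ℝ ∞ g) (j : Fin 3) :
    Continuous (partialDeriv j g) :=
  (hg.continuous_fderiv (by simp)).clm_apply continuous_const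

theorem hasCompactSupport_partialDeriv {g : E3 → ℝ} (hg : HasCompactSupport g) (j : Fin 3) :
    HasCompactSupport (partialDeriv j g) :=
  hg.fderiv_apply ℝ _

/-- The space `C₀^∞(ℝ³)` of smooth compactly supported functions, as a subspace of `L²(ℝ³)`. -/
def testFunctions : Submodule ℂ L2 where
  carrier := {ψ | ∃ f : E3 → ℂ, ContDiff ℝ ∞ f ∧ HasCompactSupport f ∧ ψ =ᵐ[volume] f}
  zero_mem' := ⟨0, contDiff_const, HasCompactSupport.zero, Lp.coeFn_zero _ _ _⟩
  add_mem' := by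
    rintro ψ χ ⟨f, hf, hf', h⟩ ⟨g, hg, hg', h'⟩
    exact ⟨f + g, hf.add hg, hf'.add hg', (Lp.coeFn_add _ _).trans (h.add h')⟩
  smul_mem' := by
    rintro c ψ ⟨f, hf, hf', h⟩
    exact ⟨c • f, hf.const_smul c, hf'.smul_left (f := fun _ => c),
      (Lp.coeFn_smul _ _).trans (h.const_smul c)⟩

/-- The graph of `pⱼ = -i ∂ⱼ` with distributional derivative: the pairs `(ψ, χ)` in `L²` with
`∫ g χ = i ∫ (∂ⱼ g) ψ` for every (real) test function `g`. -/
def momentumGraph (j : Fin 3) : Submodule ℂ (L2 × L2) where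
  carrier := {z | ∀ g : E3 → ℝ, ContDiff ℝ ∞ g → HasCompactSupport g →
    ∫ x, g x • z.2 x = Complex.I * ∫ x, partialDeriv j g x • z.1 x}
  zero_mem' := by
    intro g _ _
    have h0 : ∀ k : E3 → ℝ, ∫ x, k x • (0 : L2) x = 0 := fun k => by
      rw [integral_eq_zero_of_ae]
      filter_upwards [Lp.coeFn_zero ℂ 2 (volume : Measure E3)] with x hx
      rw [hx, Pi.zero_apply, smul_zero]
    change ∫ x, g x • (0 : L2) x = Complex.I * ∫ x, partialDeriv j g x • (0 : L2) x
    rw [h0, h0, mul_zero]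
  add_mem' := by
    intro z w hz hw g hg hg'
    have key : ∀ {k : E3 → ℝ}, Continuous k → HasCompactSupport k → ∀ ψ χ : L2,
        ∫ x, k x • (ψ + χ) x = (∫ x, k x • ψ x) + ∫ x, k x • χ x := fun hk hk' ψ χ => by
      rw [← integral_add (integrable_smul_L2 hk hk' ψ) (integrable_smul_L2 hk hk' χ)]
      refine integral_congr_ae ?_
      filter_upwards [Lp.coeFn_add ψ χ] with x hx
      rw [hx, Pi.add_apply, smul_add]
    rw [Prod.fst_add, Prod.snd_add, key hg.continuous hg',
      key (continuous_partialDeriv hg j) (hasCompactSupport_partialDeriv hg' j),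
      hz g hg hg', hw g hg hg', mul_add]
  smul_mem' := by
    intro c z hz g hg hg'
    have key : ∀ (k : E3 → ℝ) (ψ : L2), ∫ x, k x • (c • ψ) x = c * ∫ x, k x • ψ x := by
      intro k ψ
      rw [← integral_const_mul]
      refine integral_congr_ae ?_
      filter_upwards [Lp.coeFn_smul c ψ] with x hx
      simp only [hx, Pi.smul_apply, smul_eq_mul, Complex.real_smul]
      ring
    rw [Prod.smul_fst, Prod.smul_snd, key, key, hz g hg hg']
    ring

theorem momentumGraph_single_valued (j : Fin 3) :
    ∀ z ∈ momentumGraph j, z.1 = 0 → z.2 = 0 := by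
  intro z hz h0
  rw [Lp.eq_zero_iff_ae_eq_zero]
  refine ae_eq_zero_of_integral_contDiff_smul_eq_zero
    ((Lp.memLp z.2).locallyIntegrable (by norm_num)) fun g hg hg' => ?_
  rw [hz g hg hg', h0, integral_eq_zero_of_ae, mul_zero]
  filter_upwards [Lp.coeFn_zero ℂ 2 (volume : Measure E3)] with x hx
  rw [hx, Pi.zero_apply, smul_zero]

/-- The momentum operator `pⱼ = -i ∂ⱼ` on its maximal domain in `L²(ℝ³)`. -/
def momentum (j : Fin 3) : L2 →ₗ.[ℂ] L2 := (momentumGraph j).toLinearPMap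

/-- The graph of the multiplication by the coordinate `xⱼ`: the pairs `(ψ, χ)` in `L²` with
`χ = xⱼ ψ` almost everywhere. -/
def positionGraph (j : Fin 3) : Submodule ℂ (L2 × L2) where
  carrier := {z | ∀ᵐ x : E3, z.2 x = x j • z.1 x}
  zero_mem' := by
    change ∀ᵐ x : E3, (0 : L2) x = x j • (0 : L2) x
    filter_upwards [Lp.coeFn_zero ℂ 2 (volume : Measure E3)] with x hx
    rw [hx, Pi.zero_apply, smul_zero]
  add_mem' := by
    intro z w hz hw
    change ∀ᵐ x : E3, (z.2 + w.2) x = x j • (z.1 + w.1) x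
    filter_upwards [hz, hw, Lp.coeFn_add z.1 w.1, Lp.coeFn_add z.2 w.2] with x h1 h2 h3 h4
    rw [h3, h4, Pi.add_apply, Pi.add_apply, h1, h2, smul_add]
  smul_mem' := by
    intro c z hz
    change ∀ᵐ x : E3, (c • z.2) x = x j • (c • z.1) x
    filter_upwards [hz, Lp.coeFn_smul c z.1, Lp.coeFn_smul c z.2] with x h1 h3 h4
    rw [h3, h4, Pi.smul_apply, Pi.smul_apply, h1, smul_comm]

theorem positionGraph_single_valued (j : Fin 3) :
    ∀ z ∈ positionGraph j, z.1 = 0 → z.2 = 0 := by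
  intro z hz h0
  rw [Lp.eq_zero_iff_ae_eq_zero]
  filter_upwards [hz, Lp.coeFn_zero ℂ 2 (volume : Measure E3)] with x h1 h2
  rw [h1, h0, h2, Pi.zero_apply, smul_zero]

/-- The position operator: multiplication by the coordinate `xⱼ`, on its maximal domain. -/
def position (j : Fin 3) : L2 →ₗ.[ℂ] L2 := (positionGraph j).toLinearPMap

/-- Multiplication by a bounded real function, as an everywhere defined operator in `L²(ℝ³)`. -/
def mulBounded (f : LInf) : L2 →ₗ[ℂ] L2 where
  toFun ψ := f • ψ
  map_add' ψ χ := Lp.add_smul f ψ χ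
  map_smul' c ψ := by
    refine Lp.ext ?_
    filter_upwards [Lp.coeFn_lpSMul (r := 2) f (c • ψ), Lp.coeFn_smul c (f • ψ : L2),
      Lp.coeFn_lpSMul (r := 2) f ψ, Lp.coeFn_smul c ψ] with x h1 h2 h3 h4
    rw [h1, RingHom.id_apply, h2, Pi.smul_apply, h3, Pi.smul_apply', h4, Pi.smul_apply,
      Pi.smul_apply', smul_comm]

theorem mulBounded_apply (f : LInf) (ψ : L2) :
    mulBounded f ψ =ᵐ[volume] fun x => f x • ψ x :=
  Lp.coeFn_lpSMul f ψ

/-- The form domain `D(q₀) = D(p) ∩ D(x)` (componentwise). -/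
def formDomain : Submodule ℂ L2 :=
  (⨅ j, (momentum j).domain) ⊓ ⨅ j, (position j).domain

/-- `pⱼ` on the form domain. -/
def pOn (j : Fin 3) : formDomain →ₗ[ℂ] L2 :=
  (momentum j).toFun.comp (Submodule.inclusion (inf_le_left.trans (iInf_le _ j)))

/-- `xⱼ` on the form domain. -/
def xOn (j : Fin 3) : formDomain →ₗ[ℂ] L2 :=
  (position j).toFun.comp (Submodule.inclusion (inf_le_right.trans (iInf_le _ j)))

/-- The kinetic momentum `πⱼ = pⱼ - aⱼ` on the form domain. -/
def piOn (a : Fin 3 → LInf) (j : Fin 3) : formDomain →ₗ[ℂ] L2 :=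
  pOn j - (mulBounded (a j)).comp formDomain.subtype

/-- The sesquilinear form `(φ, ψ) ↦ ⟪S φ, T ψ⟫` on the form domain. -/
def pairing (S T : formDomain →ₗ[ℂ] L2) : formDomain →ₗ⋆[ℂ] formDomain →ₗ[ℂ] ℂ :=
  LinearMap.mk₂'ₛₗ (starRingEnd ℂ) (RingHom.id ℂ) (fun φ ψ => inner ℂ (S φ) (T ψ))
    (by simp [inner_add_left]) (by simp [inner_smul_left])
    (by simp [inner_add_right]) (by simp [inner_smul_right])

/-- The oscillator form
`q₀(φ, ψ) = ½ ∑ⱼ ⟪pⱼ φ, pⱼ ψ⟫ + ½ ∑ⱼ ⟪xⱼ φ, xⱼ ψ⟫` on `D(p) ∩ D(x)`. -/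
def oscillatorForm : SesqForm L2 where
  domain := formDomain
  form := (1 / 2 : ℂ) • (∑ j, pairing (pOn j) (pOn j)) +
    (1 / 2 : ℂ) • ∑ j, pairing (xOn j) (xOn j)

/-- The form
`q(φ, ψ) = ½ ∑ⱼ ⟪πⱼ φ, πⱼ ψ⟫ + ½ ∑ⱼ ⟪xⱼ φ, xⱼ ψ⟫ + ⟪φ, v ψ⟫`, where `πⱼ = pⱼ - aⱼ`,
on the domain of the oscillator form. -/
def magneticForm (a : Fin 3 → LInf) (v : LInf) : SesqForm L2 where
  domain := oscillatorForm.domain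
  form := (1 / 2 : ℂ) • (∑ j, pairing (piOn a j) (piOn a j)) +
    (1 / 2 : ℂ) • (∑ j, pairing (xOn j) (xOn j)) +
    pairing formDomain.subtype ((mulBounded v).comp formDomain.subtype)

theorem oscillatorForm_apply (φ ψ : formDomain) :
    oscillatorForm.form φ ψ = 1 / 2 * (∑ j, inner ℂ (pOn j φ) (pOn j ψ)) +
      1 / 2 * ∑ j, inner ℂ (xOn j φ) (xOn j ψ) := by
  change ((1 / 2 : ℂ) • (∑ j, pairing (pOn j) (pOn j)) +
    (1 / 2 : ℂ) • ∑ j, pairing (xOn j) (xOn j)) φ ψ = _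
  simp only [LinearMap.add_apply, LinearMap.smul_apply, LinearMap.sum_apply, smul_eq_mul]
  rfl

theorem magneticForm_apply (a : Fin 3 → LInf) (v : LInf) (φ ψ : formDomain) :
    (magneticForm a v).form φ ψ = 1 / 2 * (∑ j, inner ℂ (piOn a j φ) (piOn a j ψ)) +
      1 / 2 * (∑ j, inner ℂ (xOn j φ) (xOn j ψ)) + inner ℂ (φ : L2) (mulBounded v ψ) := by
  change ((1 / 2 : ℂ) • (∑ j, pairing (piOn a j) (piOn a j)) +
    (1 / 2 : ℂ) • (∑ j, pairing (xOn j) (xOn j)) +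
    pairing formDomain.subtype ((mulBounded v).comp formDomain.subtype)) φ ψ = _
  simp only [LinearMap.add_apply, LinearMap.smul_apply, LinearMap.sum_apply, smul_eq_mul]
  rfl

/-- The unperturbed hamiltonian `h₀ = ½ (p² + x²)`, the operator determined by `q₀`. -/
def oscillatorHamiltonian : L2 →ₗ.[ℂ] L2 := oscillatorForm.operator

/-- The hamiltonian `h = ½ (π² + x²) + v`, the operator determined by `q`. -/
def hamiltonian (a : Fin 3 → LInf) (v : LInf) : L2 →ₗ.[ℂ] L2 := (magneticForm a v).operator

/-- The distributional divergence of the vector field `a` is a bounded function `d`: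
`∫ ∑ⱼ aⱼ ∂ⱼ g = -∫ d g` for every test function `g`. -/
def HasBoundedDivergence (a : Fin 3 → LInf) : Prop :=
  ∃ d : LInf, ∀ g : E3 → ℝ, ContDiff ℝ ∞ g → HasCompactSupport g →
    ∫ x, ∑ j, a j x * partialDeriv j g x = -∫ x, d x * g x

end MagneticOscillator

end

open MagneticOscillator

/-! The abstract half is the two representation theorems for a closed form `q` with `q + α` strictly
positive. The form domain with inner product `q + α⟪·,·⟫` is a Hilbert space `E` (closedness is
completeness), and its inclusion `J : E → H` is bounded and injective. The bounded operator `G = J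
J*` is the inverse of `h + α`, so self-adjointness of `h` reduces to that of `G`. The square root of
`h + α` is the inverse of `√G`, and `√G (√G)* = J J*` forces `ran √G = ran J`, which is the form
domain. Density of `ran J*` in `E` says that the operator domain is dense in the form norm
(`SesqForm.exists_resolvent`).

The concrete half rests on coercivity: up to `‖v‖ ‖φ‖²` the form dominates `‖π φ‖²` and `‖x φ‖²`
(`sum_norm_sq_le`). Since `a` is bounded, control of `φ` and `π φ` is control of `p φ`. As `p` and
`x` have closed graphs, `q` is closed, and approximation in `φ`, `p φ`, `x φ` gives approximation in
every form `q`.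

The analytic core is `mem_closure_oscTestGraph`: test functions are graph dense for `½ (p² + x²)`. A
cutoff produces commutators tending to zero, and mollification commutes with `p²`, while `x²` is
bounded on a fixed ball. Since `q₀(w, w) = ⟪w, h₀ w⟫`, graph convergence implies form convergence,
and density of `D(h₀)` in the form norm makes the test functions a form core.

If the divergence `d` of `a` is bounded, integration by parts extends from the core to the form
domain and gives `q(φ, ψ) = q₀(φ, ψ) + ⟪φ, B ψ⟫` with `B = -a·p + ½ a² + ½ i d + v` defined on the
whole form domain (`IsDivergence.magForm_eq`). Hence `h = h₀ + B` on the same domain. Approximants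
in the graph of `h₀` also converge after applying `B`, so the closure of `h` on test functions is
`h`. -/

namespace MagneticOscillator

/-! ### Unbounded operators described through bounded inverses -/

section HilbertSpace

variable {H E F : Type*} [NormedAddCommGroup H] [InnerProductSpace ℂ H]
  [NormedAddCommGroup E] [InnerProductSpace ℂ E] [NormedAddCommGroup F] [InnerProductSpace ℂ F]

theorem exists_eq_of_mem_graph {T : H →ₗ.[ℂ] H} {ψ χ : H} (h : (ψ, χ) ∈ T.graph) :
    ∃ x : T.domain, (x : H) = ψ ∧ T x = χ := by
  simpa [LinearPMap.mem_graph_iff] using h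

theorem mem_graph_shift {T : H →ₗ.[ℂ] H} {c : ℝ} {ψ χ : H} :
    (ψ, χ) ∈ (shift T c).graph ↔ (ψ, χ - (c : ℂ) • ψ) ∈ T.graph := by
  simp only [LinearPMap.mem_graph_iff]
  constructor
  · rintro ⟨x, rfl, hx⟩
    refine ⟨x, rfl, ?_⟩
    rw [← hx]
    change T x = ((c : ℂ) • (x : H) + T x) - _
    simp
  · rintro ⟨x, rfl, hx⟩
    refine ⟨x, rfl, ?_⟩
    change ((c : ℂ) • (x : H) + T x) = _
    rw [hx]; simp

/-- The inverse of an injective bounded operator. -/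
theorem exists_graph_inverse {R : H →L[ℂ] H} (hR : Function.Injective R) :
    ∃ S : H →ₗ.[ℂ] H, ∀ ψ χ, (ψ, χ) ∈ S.graph ↔ R χ = ψ := by
  let g : Submodule ℂ (H × H) :=
    LinearMap.range ((R : H →ₗ[ℂ] H).prod LinearMap.id)
  have hg : ∀ ψ χ, (ψ, χ) ∈ g ↔ R χ = ψ := by
    intro ψ χ
    simp [g, LinearMap.mem_range]
  refine ⟨g.toLinearPMap, fun ψ χ => ?_⟩
  rw [Submodule.toLinearPMap_graph_eq, hg]
  rintro ⟨ψ, χ⟩ hx rfl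
  rw [hg] at hx
  exact hR (by simpa using hx)

variable [CompleteSpace H]

/-- The hypothesis says `G = (T + c)⁻¹`. Testing the adjoint relation on the pairs `(G f, f - c G
f)` and moving `G` across the inner product returns the equation that defines the graph of `T`. -/
theorem isSelfAdjoint_of_mem_graph_iff {T : H →ₗ.[ℂ] H} {G : H →L[ℂ] H} (hG : IsSelfAdjoint G)
    (c : ℝ) (h : ∀ ψ χ, (ψ, χ) ∈ T.graph ↔ G (χ + (c : ℂ) • ψ) = ψ) : IsSelfAdjoint T := by
  have hsymm : ∀ x y, inner ℂ (G x) y = inner ℂ x (G y) := hG.isSymmetric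
  have hmem : ∀ f, (G f, f - (c : ℂ) • G f) ∈ T.graph := fun f => by rw [h]; simp
  have hdense : Dense (T.domain : Set H) := by
    rw [Submodule.dense_iff_topologicalClosure_eq_top,
      Submodule.topologicalClosure_eq_top_iff, Submodule.eq_bot_iff]
    intro y hy
    rw [Submodule.mem_orthogonal'] at hy
    -- The domain contains the range of `G`, so a vector orthogonal to it lies in `ker G`; then `(0,
    -- y)` is in the graph and `y = 0`.
    have hy0 : G y = 0 := by
      refine ext_inner_right ℂ fun f => ?_
      rw [hsymm, inner_zero_left]
      obtain ⟨x, hx, -⟩ := exists_eq_of_mem_graph (hmem f)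
      rw [← hx]
      exact hy x x.2
    have : ((0 : H), y) ∈ T.graph := by rw [h]; simpa using hy0
    exact T.graph_fst_eq_zero_snd this rfl
  rw [LinearPMap.isSelfAdjoint_def]
  refine LinearPMap.eq_of_eq_graph ?_
  rw [LinearPMap.adjoint_graph_eq_graph_adjoint hdense]
  ext ⟨y, z⟩
  rw [Submodule.mem_adjoint_iff, h]
  constructor
  · intro hyz
    refine ext_inner_left ℂ fun f => ?_
    have := hyz _ _ (hmem f)
    simp only [inner_sub_left, inner_smul_left, Complex.conj_ofReal] at this
    rw [map_add, map_smul, inner_add_right, inner_smul_right, ← hsymm, ← hsymm]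
    linear_combination -this
  · intro hyz a b hab
    rw [h] at hab
    have h1 : inner ℂ (b + (c : ℂ) • a) y = inner ℂ a (z + (c : ℂ) • y) := by
      conv_lhs => rw [← hyz]
      rw [← hsymm, hab]
    simp only [inner_add_left, inner_add_right, inner_smul_left, inner_smul_right,
      Complex.conj_ofReal] at h1
    simp only
    linear_combination h1

/-- Passing to adjoints reverses the inclusion, so a self-adjoint operator has no proper
self-adjoint extension. -/
theorem eq_of_le_of_isSelfAdjoint {S T : H →ₗ.[ℂ] H} (hS : IsSelfAdjoint S)
    (hT : IsSelfAdjoint T) (h : S ≤ T) : S = T := by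
  refine le_antisymm h ?_
  rw [← LinearPMap.isSelfAdjoint_def.1 hS]
  refine LinearPMap.IsFormalAdjoint.le_adjoint hS.dense_domain fun x y => ?_
  have h1 := LinearPMap.adjoint_isFormalAdjoint hT.dense_domain
  rw [LinearPMap.isSelfAdjoint_def.1 hT] at h1
  rw [← h1 ⟨x, h.1 x.2⟩ y]
  congr 1
  exact h.2 rfl

/-- With `A = G⁻¹`, this moves existence and uniqueness of unbounded roots to the unique nonnegative
root of the bounded operator `G`. -/
theorem isPositiveSqrt_iff {A : H →ₗ.[ℂ] H} {G : H →L[ℂ] H} (hG : 0 ≤ G)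
    (hA : ∀ ψ χ, (ψ, χ) ∈ A.graph ↔ G χ = ψ) (S : H →ₗ.[ℂ] H) :
    IsPositiveSqrt S A ↔ ∀ ψ χ, (ψ, χ) ∈ S.graph ↔ CFC.sqrt G χ = ψ := by
  constructor
  · rintro ⟨hS, hpos, hsq⟩
    -- `S` inherits surjectivity and injectivity from `A = S ∘ S`, so its inverse `L` is defined on
    -- all of `H`.
    have hsurj : ∀ χ, ∃ η, (η, χ) ∈ S.graph := fun χ => by
      obtain ⟨η, -, hη⟩ := (hsq (G χ) χ).1 ((hA _ _).2 rfl)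
      exact ⟨η, hη⟩
    have hinj : ∀ ψ, (ψ, (0 : H)) ∈ S.graph → ψ = 0 := fun ψ hψ => by
      have := (hsq ψ 0).2 ⟨0, hψ, S.graph.zero_mem⟩
      rw [hA] at this
      simpa using this.symm
    have huniq : ∀ {ψ ψ' χ}, (ψ, χ) ∈ S.graph → (ψ', χ) ∈ S.graph → ψ = ψ' := by
      intro ψ ψ' χ h h'
      have := S.graph.sub_mem h h'
      exact sub_eq_zero.1 (hinj _ (by simpa using this))
    choose L hL using hsurj
    let L' : H →ₗ[ℂ] H :=
      { toFun := L
        map_add' := fun x y => huniq (hL _) (by simpa using S.graph.add_mem (hL x) (hL y))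
        map_smul' := fun c x => huniq (hL _) (by simpa using S.graph.smul_mem c (hL x)) }
    have hsymm : L'.IsSymmetric := by
      intro x y
      obtain ⟨u, hu, hu'⟩ := exists_eq_of_mem_graph (hL x)
      obtain ⟨w, hw, hw'⟩ := exists_eq_of_mem_graph (hL y)
      have h1 := LinearPMap.adjoint_isFormalAdjoint hS.dense_domain
      rw [LinearPMap.isSelfAdjoint_def.1 hS] at h1
      have := h1 u w
      rw [hu', hw', hu, hw] at this
      exact this.symm
    -- Hellinger–Toeplitz: a symmetric operator defined everywhere is bounded.
    let R : H →L[ℂ] H := (hsymm.toSelfAdjoint : H →L[ℂ] H)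
    have hR : ∀ x, R x = L x := fun x => rfl
    have hR0 : 0 ≤ R := by
      rw [ContinuousLinearMap.nonneg_iff_isPositive, ContinuousLinearMap.isPositive_def']
      refine ⟨hsymm.toSelfAdjoint.2, fun x => ?_⟩
      obtain ⟨u, hu, hu'⟩ := exists_eq_of_mem_graph (hL x)
      have := hpos u
      rw [hu', hu] at this
      exact this
    have hRR : R * R = G := by
      ext χ
      change L (L χ) = G χ
      exact ((hA _ _).1 ((hsq _ _).2 ⟨L χ, hL _, hL _⟩)).symm
    rw [CFC.sqrt_unique hRR]
    intro ψ χ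
    rw [hR]
    exact ⟨fun h => huniq (hL _) h, fun h => h ▸ hL χ⟩
  · intro h
    have hR0 : 0 ≤ (CFC.sqrt G : H →L[ℂ] H) := CFC.sqrt_nonneg G
    have hRR := CFC.sqrt_mul_sqrt_self G hG
    have hpos := (ContinuousLinearMap.nonneg_iff_isPositive _).1 hR0
    refine ⟨isSelfAdjoint_of_mem_graph_iff hpos.isSelfAdjoint 0 (by simpa using h), ?_, ?_⟩
    · intro ψ
      have := (h _ _).1 (S.mem_graph ψ)
      conv_rhs => rw [← this]
      exact hpos.re_inner_nonneg_left _
    · intro ψ χ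
      rw [hA, ← hRR]
      constructor
      · exact fun h1 => ⟨CFC.sqrt G χ, (h _ _).2 h1, (h _ _).2 rfl⟩
      · rintro ⟨η, h1, h2⟩
        rw [h] at h1 h2
        rw [← h1, ← h2]; rfl

theorem existsUnique_isPositiveSqrt {A : H →ₗ.[ℂ] H} {G : H →L[ℂ] H} (hG : 0 ≤ G)
    (hA : ∀ ψ χ, (ψ, χ) ∈ A.graph ↔ G χ = ψ) : ∃! S : H →ₗ.[ℂ] H, IsPositiveSqrt S A := by
  have hinj : Function.Injective (CFC.sqrt G : H →L[ℂ] H) := by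
    rw [injective_iff_map_eq_zero]
    intro χ hχ
    have h0 : G χ = 0 := by
      rw [← CFC.sqrt_mul_sqrt_self G hG]
      change CFC.sqrt G (CFC.sqrt G χ) = 0
      rw [hχ, map_zero]
    exact A.graph_fst_eq_zero_snd ((hA _ _).2 h0) rfl
  obtain ⟨S, hS⟩ := exists_graph_inverse hinj
  refine ⟨S, (isPositiveSqrt_iff hG hA S).2 hS, fun S' hS' => ?_⟩
  replace hS' := (isPositiveSqrt_iff hG hA S').1 hS'
  refine LinearPMap.eq_of_eq_graph ?_
  ext ⟨ψ, χ⟩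
  rw [hS, hS']

/-! ### Ranges of factors in `J J*` -/

variable [CompleteSpace E] [CompleteSpace F]

theorem denseRange_adjoint {J : E →L[ℂ] H} (hJ : Function.Injective J) :
    DenseRange (ContinuousLinearMap.adjoint J) := by
  have h : (LinearMap.range (ContinuousLinearMap.adjoint J : H →ₗ[ℂ] E)).topologicalClosure = ⊤ := by
    rw [Submodule.topologicalClosure_eq_top_iff, Submodule.eq_bot_iff]
    intro y hy
    rw [Submodule.mem_orthogonal'] at hy
    refine hJ ?_
    rw [map_zero]
    refine ext_inner_right ℂ fun f => ?_
    rw [inner_zero_left, ← ContinuousLinearMap.adjoint_inner_right]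
    exact hy _ ⟨f, rfl⟩
  have := (Submodule.dense_iff_topologicalClosure_eq_top).2 h
  exact this

/-- Equality of `J J*` and `K K*` gives `‖J* f‖ = ‖K* f‖`, so `J* f ↦ K* f` is isometric on a dense
subspace of `E`. If `J* fₙ → e`, then `K* fₙ` converges to some `w`, and `K w = J e`. -/
theorem range_subset_range_of_comp_adjoint_eq {J : E →L[ℂ] H} {K : F →L[ℂ] H}
    (hJ : Function.Injective J)
    (h : J ∘L ContinuousLinearMap.adjoint J = K ∘L ContinuousLinearMap.adjoint K) :
    Set.range J ⊆ Set.range K := by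
  rintro _ ⟨e, rfl⟩
  have hnorm : ∀ f, ‖ContinuousLinearMap.adjoint K f‖ = ‖ContinuousLinearMap.adjoint J f‖ := by
    intro f
    refine (sq_eq_sq₀ (norm_nonneg _) (norm_nonneg _)).1 ?_
    rw [← inner_self_eq_norm_sq (𝕜 := ℂ), ← inner_self_eq_norm_sq (𝕜 := ℂ),
      ContinuousLinearMap.adjoint_inner_right, ContinuousLinearMap.adjoint_inner_right]
    exact congrArg (fun L : H →L[ℂ] H => RCLike.re (inner ℂ (L f) f)) h.symm
  obtain ⟨u, hu, hlim⟩ := mem_closure_iff_seq_limit.1 (denseRange_adjoint hJ e)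
  choose f hf using hu
  have hcau : CauchySeq fun n => ContinuousLinearMap.adjoint K (f n) := by
    rw [Metric.cauchySeq_iff]
    intro ε hε
    obtain ⟨N, hN⟩ := Metric.cauchySeq_iff.1 hlim.cauchySeq ε hε
    refine ⟨N, fun m hm n hn => ?_⟩
    have := hN m hm n hn
    rwa [dist_eq_norm, ← hf, ← hf, ← map_sub, ← hnorm, map_sub, ← dist_eq_norm] at this
  obtain ⟨w, hw⟩ := cauchySeq_tendsto_of_complete hcau
  refine ⟨w, tendsto_nhds_unique ((K.continuous.tendsto w).comp hw) ?_⟩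
  refine ((J.continuous.tendsto e).comp hlim).congr fun n => ?_
  rw [Function.comp_apply, ← hf]
  exact DFunLike.congr_fun h (f n)

end HilbertSpace

/-! ### Representation theorems for closed forms -/

namespace SesqForm

universe u

variable {H : Type u} [NormedAddCommGroup H] [InnerProductSpace ℂ H]

/-- The form domain as a bare vector space, to carry the form norm. -/
def FormSpace (q : SesqForm H) : Type _ := q.domain

instance (q : SesqForm H) : AddCommGroup q.FormSpace :=
  inferInstanceAs (AddCommGroup q.domain)

instance (q : SesqForm H) : Module ℂ q.FormSpace :=
  inferInstanceAs (Module ℂ q.domain)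

/-- The identification of the form space with the form domain. -/
def toDomain (q : SesqForm H) : q.FormSpace ≃ₗ[ℂ] q.domain := LinearEquiv.refl ℂ q.domain

/-- The inner product `q(φ, ψ) + α ⟪φ, ψ⟫` on the form domain. -/
@[reducible] noncomputable def formCore (q : SesqForm H) (hq : q.IsHermitian) {α m : ℝ} (hm : 0 < m)
    (hpos : ∀ φ : q.domain, m * ‖(φ : H)‖ ^ 2 ≤ (q.form φ φ).re + α * ‖(φ : H)‖ ^ 2) :
    InnerProductSpace.Core ℂ q.FormSpace where
  inner φ ψ := q.form (q.toDomain φ) (q.toDomain ψ) +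
    α * inner ℂ (q.toDomain φ : H) (q.toDomain ψ)
  conj_inner_symm φ ψ := by
    rw [map_add, map_mul, Complex.conj_ofReal, inner_conj_symm]
    congr 1
    exact (hq _ _).symm
  re_inner_nonneg φ := by
    have h := hpos (q.toDomain φ)
    have h1 : 0 ≤ m * ‖(q.toDomain φ : H)‖ ^ 2 := by positivity
    have h2 := h1.trans h
    simpa [inner_self_eq_norm_sq_to_K, ← Complex.ofReal_pow] using h2
  add_left φ ψ χ := by
    rw [map_add, map_add, LinearMap.add_apply, Submodule.coe_add, inner_add_left]
    ring
  smul_left φ ψ c := by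
    rw [map_smul, map_smulₛₗ, LinearMap.smul_apply, Submodule.coe_smul, inner_smul_left,
      smul_eq_mul]
    ring
  definite φ h := by
    have h0 := congrArg Complex.re h
    simp only [inner_self_eq_norm_sq_to_K, Complex.add_re] at h0
    have h1 := hpos (q.toDomain φ)
    have h2 : m * ‖(q.toDomain φ : H)‖ ^ 2 ≤ 0 := by
      refine h1.trans (le_of_eq ?_)
      simpa [← Complex.ofReal_pow] using h0
    have h3 : ‖(q.toDomain φ : H)‖ = 0 := by
      by_contra hne
      have : 0 < ‖(q.toDomain φ : H)‖ ^ 2 := by positivity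
      nlinarith
    exact q.toDomain.injective (by rw [map_zero]; exact Subtype.ext (norm_eq_zero.1 h3))

/-- The form domain becomes a Hilbert space `E`, kept apart from the norm it inherits from `H`; `J`
is the inclusion. -/
theorem exists_formSpace (q : SesqForm H) (hq : q.IsHermitian) (hclosed : q.IsClosed)
    [CompleteSpace H] {α m : ℝ} (hm : 0 < m)
    (hpos : ∀ φ : q.domain, m * ‖(φ : H)‖ ^ 2 ≤ (q.form φ φ).re + α * ‖(φ : H)‖ ^ 2) :
    ∃ (E : Type u) (_ : NormedAddCommGroup E) (_ : InnerProductSpace ℂ E) (_ : CompleteSpace E)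
      (e : E ≃ₗ[ℂ] q.domain) (J : E →L[ℂ] H),
      (∀ x, J x = e x) ∧ ∀ x y, inner ℂ x y = q.form (e x) (e y) + α * inner ℂ (J x) (J y) := by
  let core := q.formCore hq hm hpos
  let _ : NormedAddCommGroup q.FormSpace := core.toNormedAddCommGroup
  let _ : InnerProductSpace ℂ q.FormSpace := InnerProductSpace.ofCore core.toCore
  let e := q.toDomain
  have hinner : ∀ x y : q.FormSpace,
      inner ℂ x y = q.form (e x) (e y) + α * inner ℂ (e x : H) (e y) := fun x y => rfl
  have hnorm : ∀ x : q.FormSpace, ‖x‖ ^ 2 = (q.form (e x) (e x)).re + α * ‖(e x : H)‖ ^ 2 := by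
    intro x
    rw [← inner_self_eq_norm_sq (𝕜 := ℂ), hinner, inner_self_eq_norm_sq_to_K]
    simp [← Complex.ofReal_pow]
  have hreal : ∀ x : q.domain, q.form x x = ((q.form x x).re : ℂ) := fun x =>
    (Complex.conj_eq_iff_re.1 (hq x x).symm).symm
  have hle : ∀ x : q.FormSpace, ‖(e x : H)‖ ^ 2 ≤ m⁻¹ * ‖x‖ ^ 2 := fun x => by
    rw [hnorm, inv_mul_eq_div, le_div_iff₀ hm, mul_comm]
    exact hpos (e x)
  have hbound : ∀ x : q.FormSpace, ‖(e x : H)‖ ≤ √m⁻¹ * ‖x‖ := fun x => by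
    refine le_of_sq_le_sq ?_ (by positivity)
    rw [mul_pow, Real.sq_sqrt (by positivity)]
    exact hle x
  let J : q.FormSpace →L[ℂ] H :=
    LinearMap.mkContinuous (q.domain.subtype ∘ₗ (e : q.FormSpace →ₗ[ℂ] q.domain)) (√m⁻¹) hbound
  have hJ : ∀ x, J x = e x := fun x => rfl
  refine ⟨q.FormSpace, inferInstance, inferInstance, ?_, e, J, hJ, hinner⟩
  refine Metric.complete_of_cauchySeq_tendsto fun u hu => ?_
  obtain ⟨ψ, hψ⟩ := cauchySeq_tendsto_of_complete (J.uniformContinuous.comp_cauchySeq hu)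
  obtain ⟨φ, hφ, hlim⟩ := hclosed (fun n => e (u n)) ψ hψ (by
    intro ε hε
    -- Neither `q(x, x)` nor `α` need be nonnegative, hence the bound `|q(x, x)| ≤ ‖x‖² + |α| ‖J x‖²
    -- ≤ (1 + |α| / m) ‖x‖²`.
    have hc : 0 < 1 + |α| * m⁻¹ := by positivity
    obtain ⟨N, hN⟩ := Metric.cauchySeq_iff.1 hu (√(ε / (1 + |α| * m⁻¹))) (by positivity)
    refine ⟨N, fun k hk n hn => ?_⟩
    have h1 := hN k hk n hn
    rw [dist_eq_norm] at h1
    rw [← map_sub]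
    set x := u k - u n
    have h2 : ‖x‖ ^ 2 < ε / (1 + |α| * m⁻¹) := by
      have := pow_lt_pow_left₀ h1 (norm_nonneg _) two_ne_zero
      rwa [Real.sq_sqrt (by positivity)] at this
    rw [lt_div_iff₀ hc] at h2
    rw [hreal, Complex.norm_real, Real.norm_eq_abs]
    have h3 : (q.form (e x) (e x)).re = ‖x‖ ^ 2 - α * ‖(e x : H)‖ ^ 2 := by rw [hnorm]; ring
    rw [h3]
    refine lt_of_le_of_lt (abs_sub _ _) ?_
    rw [abs_mul, abs_of_nonneg (sq_nonneg ‖x‖), abs_of_nonneg (sq_nonneg ‖(e x : H)‖)]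
    have := mul_le_mul_of_nonneg_left (hle x) (abs_nonneg α)
    nlinarith)
  refine ⟨e.symm φ, ?_⟩
  rw [tendsto_iff_norm_sub_tendsto_zero]
  have hsq : Tendsto (fun n => ‖u n - e.symm φ‖ ^ 2) atTop (𝓝 0) := by
    have h1 : Tendsto (fun n => ‖(e (u n) : H) - φ‖) atTop (𝓝 0) := by
      rw [← tendsto_iff_norm_sub_tendsto_zero, hφ]; exact hψ
    have h2 := (Complex.continuous_re.tendsto _).comp hlim
    have h3 := h2.add ((h1.pow 2).const_mul α)
    simp only [Complex.zero_re, ne_eq, OfNat.ofNat_ne_zero, not_false_eq_true, zero_pow,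
      mul_zero, add_zero] at h3
    refine h3.congr fun n => ?_
    rw [hnorm, map_sub, LinearEquiv.apply_symm_apply]
    rfl
  have := (Real.continuous_sqrt.tendsto _).comp hsq
  simpa [Function.comp_def, Real.sqrt_sq] using this

/-- All four properties come from `G = J J*`, the resolvent at `-α`; the last is density of `ran J*`
in `E`, whose elements lie in the operator domain. -/
theorem exists_resolvent (q : SesqForm H) [CompleteSpace H] (hq : q.IsHermitian)
    (hclosed : q.IsClosed) (hdense : Dense (q.domain : Set H)) {α m : ℝ} (hm : 0 < m)
    (hpos : ∀ φ : q.domain, m * ‖(φ : H)‖ ^ 2 ≤ (q.form φ φ).re + α * ‖(φ : H)‖ ^ 2) :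
    ∃ G : H →L[ℂ] H, 0 ≤ G ∧
      (∀ ψ χ, (ψ, χ) ∈ q.operatorGraph ↔ G (χ + (α : ℂ) • ψ) = ψ) ∧
      (Set.range (CFC.sqrt G : H →L[ℂ] H) = q.domain) ∧
      ∀ φ : q.domain, ∃ u : ℕ → q.domain, (∀ n, ∃ χ, ((u n : H), χ) ∈ q.operatorGraph) ∧
        Tendsto (fun n => (u n : H)) atTop (𝓝 (φ : H)) ∧
        Tendsto (fun n => q.form (u n - φ) (u n - φ)) atTop (𝓝 0) := by
  obtain ⟨E, _, _, _, e, J, hJ, hinner⟩ := q.exists_formSpace hq hclosed hm hpos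
  have hinj : Function.Injective J := fun x y h => by
    rw [hJ, hJ] at h
    exact e.injective (Subtype.ext h)
  have hrange : Set.range J = q.domain := by
    ext y
    constructor
    · rintro ⟨x, rfl⟩
      rw [hJ]; exact (e x).2
    · intro hy
      exact ⟨e.symm ⟨y, hy⟩, by rw [hJ]; simp⟩
  set G := J ∘L ContinuousLinearMap.adjoint J with hG
  have hG0 : 0 ≤ G := by
    rw [ContinuousLinearMap.nonneg_iff_isPositive]
    exact ContinuousLinearMap.isPositive_self_comp_adjoint J
  have hgraph : ∀ ψ χ, (ψ, χ) ∈ q.operatorGraph ↔ G (χ + (α : ℂ) • ψ) = ψ := by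
    intro ψ χ
    -- Adding `α⟪φ, J x⟫` turns the defining equation into `⟪y, x⟫ = ⟪J y, χ + α J x⟫` for all `y`
    -- in `E`.
    have key : ∀ x : E, (∀ φ : q.domain, q.form φ (e x) = inner ℂ (φ : H) χ) ↔
        ContinuousLinearMap.adjoint J (χ + (α : ℂ) • J x) = x := by
      intro x
      constructor
      · intro h
        refine ext_inner_left ℂ fun y => ?_
        rw [ContinuousLinearMap.adjoint_inner_right, hinner, h, inner_add_right,
          inner_smul_right, hJ, hJ]
      · intro h φ
        have h1 := hinner (e.symm φ) x
        conv_lhs at h1 => rw [← h]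
        rw [ContinuousLinearMap.adjoint_inner_right, inner_add_right, inner_smul_right, hJ,
          LinearEquiv.apply_symm_apply] at h1
        linear_combination -h1
    constructor
    · rintro ⟨ψ', rfl, h⟩
      have h1 := (key (e.symm ψ')).1 (by simpa using h)
      have h2 : J (e.symm ψ') = ψ' := by rw [hJ]; simp
      rw [h2] at h1
      change J (ContinuousLinearMap.adjoint J (χ + (α : ℂ) • (ψ' : H))) = (ψ' : H)
      rw [h1, h2]
    · intro h
      have h2 : J (ContinuousLinearMap.adjoint J (χ + (α : ℂ) • ψ)) = ψ := h
      refine ⟨e (ContinuousLinearMap.adjoint J (χ + (α : ℂ) • ψ)), by rw [← hJ, h2], ?_⟩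
      rw [key, h2]
  refine ⟨G, hG0, hgraph, ?_, ?_⟩
  · have hR : IsSelfAdjoint (CFC.sqrt G) :=
      ((ContinuousLinearMap.nonneg_iff_isPositive _).1 (CFC.sqrt_nonneg G)).isSelfAdjoint
    have hRR : CFC.sqrt G ∘L ContinuousLinearMap.adjoint (CFC.sqrt G) =
        J ∘L ContinuousLinearMap.adjoint J := by
      rw [ContinuousLinearMap.isSelfAdjoint_iff'.1 hR]
      exact CFC.sqrt_mul_sqrt_self G hG0
    have hRinj : Function.Injective (CFC.sqrt G : H →L[ℂ] H) := by
      rw [injective_iff_map_eq_zero]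
      intro χ hχ
      have h0 : G χ = 0 := by
        rw [← CFC.sqrt_mul_sqrt_self G hG0]
        change CFC.sqrt G (CFC.sqrt G χ) = 0
        rw [hχ, map_zero]
      exact q.operatorGraph_single_valued hdense (0, χ) ((hgraph _ _).2 (by simpa using h0)) rfl
    rw [← hrange]
    exact Set.Subset.antisymm (range_subset_range_of_comp_adjoint_eq hRinj hRR)
      (range_subset_range_of_comp_adjoint_eq hinj hRR.symm)
  · intro φ
    obtain ⟨u, hu, hlim⟩ := mem_closure_iff_seq_limit.1 (denseRange_adjoint hinj (e.symm φ))
    have hJlim : Tendsto (fun n => (e (u n) : H)) atTop (𝓝 (φ : H)) := by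
      have := (J.continuous.tendsto _).comp hlim
      simpa [Function.comp_def, hJ] using this
    refine ⟨fun n => e (u n), fun n => ?_, hJlim, ?_⟩
    · obtain ⟨f, hf⟩ := hu n
      refine ⟨f - (α : ℂ) • (e (u n) : H), ?_⟩
      rw [hgraph, sub_add_cancel, ← hJ, ← hf]
      rfl
    · have h1 : Tendsto (fun n => u n - e.symm φ) atTop (𝓝 0) := by
        simpa using hlim.sub_const (e.symm φ)
      have h2 := (h1.inner h1 (𝕜 := ℂ)).sub
        ((((J.continuous.tendsto _).comp h1).inner ((J.continuous.tendsto _).comp h1)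
          (𝕜 := ℂ)).const_mul (α : ℂ))
      simp only [map_zero, inner_zero_right, mul_zero, sub_zero] at h2
      refine h2.congr fun n => ?_
      simp only [Function.comp_apply]
      rw [hinner, map_sub, LinearEquiv.apply_symm_apply]
      ring

end SesqForm

/-! ### Test functions and weakly defined operators -/

/-- Complex test functions on `ℝ³`. -/
def testSpace : Submodule ℂ (E3 → ℂ) where
  carrier := {f | ContDiff ℝ ∞ f ∧ HasCompactSupport f}
  zero_mem' := ⟨contDiff_const, HasCompactSupport.zero⟩
  add_mem' hf hg := ⟨hf.1.add hg.1, hf.2.add hg.2⟩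
  smul_mem' c _ hf := ⟨hf.1.const_smul c, hf.2.smul_left (f := fun _ => c)⟩

/-- The type of complex test functions on `ℝ³`. -/
abbrev TestFn : Type := testSpace

namespace TestFn

theorem contDiff (f : TestFn) : ContDiff ℝ ∞ f.1 := f.2.1

theorem hasCompactSupport (f : TestFn) : HasCompactSupport f.1 := f.2.2

theorem continuous (f : TestFn) : Continuous f.1 := f.contDiff.continuous

theorem differentiable (f : TestFn) : Differentiable ℝ f.1 := f.contDiff.differentiable (by simp)

theorem memLp (f : TestFn) (p : ℝ≥0∞) : MemLp f.1 p (volume : Measure E3) :=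
  f.continuous.memLp_of_hasCompactSupport f.hasCompactSupport

theorem integrable (f : TestFn) : Integrable f.1 (volume : Measure E3) :=
  f.continuous.integrable_of_hasCompactSupport f.hasCompactSupport

/-- The class of a test function in `L²`. -/
noncomputable def toL2 : TestFn →ₗ[ℂ] L2 where
  toFun f := (f.memLp 2).toLp f.1
  map_add' _ _ := rfl
  map_smul' _ _ := rfl

theorem coeFn_toL2 (f : TestFn) : toL2 f =ᵐ[volume] f.1 :=
  MemLp.coeFn_toLp (f.memLp 2)

theorem toL2_mem (f : TestFn) : toL2 f ∈ testFunctions :=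
  ⟨f.1, f.contDiff, f.hasCompactSupport, coeFn_toL2 f⟩

theorem exists_toL2_eq {ψ : L2} (h : ψ ∈ testFunctions) : ∃ f : TestFn, toL2 f = ψ := by
  obtain ⟨f, hf, hf', h⟩ := h
  exact ⟨⟨f, hf, hf'⟩, Lp.ext ((coeFn_toL2 _).trans h.symm)⟩

theorem inner_toL2 (f : TestFn) (ψ : L2) :
    inner ℂ (toL2 f) ψ = ∫ x, (starRingEnd ℂ) (f.1 x) * ψ x := by
  rw [L2.inner_def]
  refine integral_congr_ae ?_
  filter_upwards [coeFn_toL2 f] with x hx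
  rw [hx, RCLike.inner_apply, mul_comm]

/-- Multiplication by a smooth function. -/
def smoothMul (u : E3 → ℂ) (hu : ContDiff ℝ ∞ u) : TestFn →ₗ[ℂ] TestFn where
  toFun f := ⟨fun x => u x * f.1 x, hu.mul f.contDiff, f.hasCompactSupport.mul_left⟩
  map_add' _ _ := Subtype.ext (funext fun _ => mul_add _ _ _)
  map_smul' _ _ := Subtype.ext (funext fun _ => mul_left_comm _ _ _)

/-- Multiplication by the coordinate `xⱼ`. -/
def x (j : Fin 3) : TestFn →ₗ[ℂ] TestFn :=
  smoothMul (fun x => (x j : ℂ)) (Complex.ofRealCLM.contDiff.comp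
    (EuclideanSpace.proj (𝕜 := ℝ) j : E3 →L[ℝ] ℝ).contDiff)

/-- Multiplication by a test function. -/
def mul (u : TestFn) : TestFn →ₗ[ℂ] TestFn := smoothMul u.1 u.contDiff

/-- The operator `-i ∂ⱼ` on test functions. -/
noncomputable def p (j : Fin 3) : TestFn →ₗ[ℂ] TestFn where
  toFun f := ⟨fun x => -Complex.I * fderiv ℝ f.1 x (EuclideanSpace.single j 1),
    contDiff_const.mul ((f.contDiff.fderiv_right (by simp)).clm_apply contDiff_const),
    (f.hasCompactSupport.fderiv_apply ℝ _).mul_left⟩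
  map_add' f g := Subtype.ext (funext fun x => by
    change -Complex.I * fderiv ℝ (f.1 + g.1) x _ = _
    rw [fderiv_add (f.differentiable x) (g.differentiable x)]
    exact mul_add _ _ _)
  map_smul' c f := Subtype.ext (funext fun x => by
    change -Complex.I * fderiv ℝ (c • f.1) x _ = c * (-Complex.I * _)
    rw [fderiv_const_smul (f.differentiable x)]
    exact mul_left_comm _ _ _)

/-- Complex conjugation of test functions. -/
def conj (f : TestFn) : TestFn :=
  ⟨fun x => (starRingEnd ℂ) (f.1 x), Complex.conjCLE.contDiff.comp f.contDiff,
    f.hasCompactSupport.comp_left (map_zero _)⟩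

/-- A real test function as a complex one. -/
def ofReal (g : E3 → ℝ) (hg : ContDiff ℝ ∞ g) (hg' : HasCompactSupport g) : TestFn :=
  ⟨fun x => (g x : ℂ), Complex.ofRealCLM.contDiff.comp hg, hg'.comp_left Complex.ofReal_zero⟩

@[simp] theorem x_apply (j : Fin 3) (f : TestFn) (y : E3) : (x j f).1 y = y j * f.1 y := rfl

@[simp] theorem mul_apply (u f : TestFn) (y : E3) : (mul u f).1 y = u.1 y * f.1 y := rfl

theorem p_apply (j : Fin 3) (f : TestFn) (y : E3) :
    (p j f).1 y = -Complex.I * fderiv ℝ f.1 y (EuclideanSpace.single j 1) := rfl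

@[simp] theorem conj_apply (f : TestFn) (y : E3) :
    (conj f).1 y = (starRingEnd ℂ) (f.1 y) := rfl

@[simp] theorem ofReal_apply (g : E3 → ℝ) (hg : ContDiff ℝ ∞ g) (hg' : HasCompactSupport g)
    (y : E3) : (ofReal g hg hg').1 y = (g y : ℂ) := rfl

@[simp] theorem add_apply (f g : TestFn) (y : E3) : (f + g).1 y = f.1 y + g.1 y := rfl

@[simp] theorem sub_apply (f g : TestFn) (y : E3) : (f - g).1 y = f.1 y - g.1 y := rfl

@[simp] theorem smul_apply (c : ℂ) (f : TestFn) (y : E3) : (c • f).1 y = c * f.1 y := rfl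

theorem ext {f g : TestFn} (h : ∀ y, f.1 y = g.1 y) : f = g := Subtype.ext (funext h)

theorem p_mul (j : Fin 3) (u f : TestFn) : p j (mul u f) = mul u (p j f) + mul (p j u) f := by
  refine ext fun y => ?_
  have h : fderiv ℝ (mul u f).1 y = u.1 y • fderiv ℝ f.1 y + f.1 y • fderiv ℝ u.1 y :=
    fderiv_mul (u.differentiable y) (f.differentiable y)
  simp only [p_apply, add_apply, mul_apply, h, _root_.add_apply, _root_.smul_apply,
    smul_eq_mul]
  ring

theorem p_conj (j : Fin 3) (f : TestFn) : p j (conj f) = -conj (p j f) := by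
  refine ext fun y => ?_
  have h : fderiv ℝ (conj f).1 y = (Complex.conjCLE : ℂ →L[ℝ] ℂ).comp (fderiv ℝ f.1 y) :=
    ((Complex.conjCLE : ℂ →L[ℝ] ℂ).hasFDerivAt.comp y (f.differentiable y).hasFDerivAt).fderiv
  change _ = -(conj (p j f)).1 y
  rw [p_apply, h, conj_apply, p_apply]
  simp

theorem p_ofReal (j : Fin 3) (g : E3 → ℝ) (hg : ContDiff ℝ ∞ g) (hg' : HasCompactSupport g)
    (y : E3) : (p j (ofReal g hg hg')).1 y = -Complex.I * partialDeriv j g y := by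
  have h : fderiv ℝ (ofReal g hg hg').1 y = Complex.ofRealCLM.comp (fderiv ℝ g y) :=
    (Complex.ofRealCLM.hasFDerivAt.comp y (hg.differentiable (by simp) y).hasFDerivAt).fderiv
  rw [p_apply, h]
  rfl

/-- Momentum and divergence are defined with real test functions; by linearity this permits complex
ones. -/
theorem eq_ofReal_add (f : TestFn) :
    ∃ g₁ h₁ h₁' g₂ h₂ h₂', f = ofReal g₁ h₁ h₁' + Complex.I • ofReal g₂ h₂ h₂' := by
  have h₁ : ContDiff ℝ ∞ fun y => (f.1 y).re := Complex.reCLM.contDiff.comp f.contDiff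
  have h₂ : ContDiff ℝ ∞ fun y => (f.1 y).im := Complex.imCLM.contDiff.comp f.contDiff
  refine ⟨_, h₁, f.hasCompactSupport.comp_left Complex.zero_re, _, h₂,
    f.hasCompactSupport.comp_left Complex.zero_im, ext fun y => ?_⟩
  simp only [add_apply, smul_apply, ofReal_apply]
  rw [mul_comm Complex.I, Complex.re_add_im]

theorem eq_zero_of_inner_toL2 {ψ : L2} (h : ∀ f, inner ℂ (toL2 f) ψ = 0) : ψ = 0 := by
  rw [Lp.eq_zero_iff_ae_eq_zero]
  refine ae_eq_zero_of_integral_contDiff_smul_eq_zero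
    ((Lp.memLp ψ).locallyIntegrable (by norm_num)) fun g hg hg' => ?_
  rw [← h (ofReal g hg hg'), inner_toL2]
  simp

theorem eq_of_inner_toL2 {ψ χ : L2} (h : ∀ f, inner ℂ (toL2 f) ψ = inner ℂ (toL2 f) χ) :
    ψ = χ :=
  sub_eq_zero.1 (eq_zero_of_inner_toL2 fun f => by rw [inner_sub_right, h, sub_self])

theorem dense_testFunctions : Dense (testFunctions : Set L2) := by
  rw [Submodule.dense_iff_topologicalClosure_eq_top,
    Submodule.topologicalClosure_eq_top_iff, Submodule.eq_bot_iff]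
  intro y hy
  rw [Submodule.mem_orthogonal] at hy
  exact eq_zero_of_inner_toL2 fun f => hy _ (toL2_mem f)

/-- Integration by parts; the sign is absorbed by the conjugate of `-i`. -/
theorem inner_toL2_p (j : Fin 3) (f g : TestFn) :
    inner ℂ (toL2 g) (toL2 (p j f)) = inner ℂ (toL2 (p j g)) (toL2 f) := by
  have key : ∀ a b : TestFn, inner ℂ (toL2 a) (toL2 b) = ∫ y, (conj a).1 y * b.1 y := by
    intro a b
    rw [inner_toL2]
    refine integral_congr_ae ?_
    filter_upwards [coeFn_toL2 b] with y hy
    rw [hy, conj_apply]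
  have hc : conj (p j g) = -p j (conj g) := by rw [p_conj, neg_neg]
  rw [key, key, hc]
  have h := integral_mul_fderiv_eq_neg_fderiv_mul_of_integrable (μ := (volume : Measure E3))
    (f := (conj g).1) (g := f.1) (v := EuclideanSpace.single j 1) (𝕜 := ℂ)
    (by
      have := (mul (p j (conj g)) f).integrable.const_mul Complex.I
      refine this.congr (.of_forall fun y => ?_)
      simp only [mul_apply, p_apply]
      linear_combination (-(fderiv ℝ (conj g).1 y (EuclideanSpace.single j 1)) * f.1 y) *
        Complex.I_sq)
    (by
      have := (mul (conj g) (p j f)).integrable.const_mul Complex.I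
      refine this.congr (.of_forall fun y => ?_)
      simp only [mul_apply, p_apply]
      linear_combination (-(conj g).1 y * fderiv ℝ f.1 y (EuclideanSpace.single j 1)) *
        Complex.I_sq)
    (mul (conj g) f).integrable (fun y _ => (conj g).differentiable y)
    (fun y _ => f.differentiable y)
  have h1 : ∀ y, (conj g).1 y * (p j f).1 y =
      -Complex.I * ((conj g).1 y * fderiv ℝ f.1 y (EuclideanSpace.single j 1)) := fun y => by
    rw [p_apply]; ring
  have h2 : ∀ y, (-p j (conj g)).1 y * f.1 y =
      Complex.I * (fderiv ℝ (conj g).1 y (EuclideanSpace.single j 1) * f.1 y) := fun y => by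
    change -(p j (conj g)).1 y * f.1 y = _
    rw [p_apply]; ring
  simp_rw [h1, h2]
  rw [integral_const_mul, integral_const_mul, h]
  ring

theorem exists_bound (u : TestFn) : ∃ C, 0 ≤ C ∧ ∀ y, ‖u.1 y‖ ≤ C := by
  obtain ⟨C, hC⟩ := u.hasCompactSupport.exists_bound_of_continuous u.continuous
  exact ⟨C, (norm_nonneg _).trans (hC 0), hC⟩

theorem memLp_mul (u : TestFn) (ψ : L2) : MemLp (fun y => u.1 y * ψ y) 2 volume := by
  obtain ⟨C, -, hC⟩ := u.exists_bound
  refine (Lp.memLp ψ).of_le_mul (c := C)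
    (u.continuous.aestronglyMeasurable.mul (Lp.aestronglyMeasurable ψ)) (.of_forall fun y => ?_)
  rw [norm_mul]
  gcongr
  exact hC y

/-- Multiplication by a test function in `L²`, as a linear map. -/
noncomputable def mulLin (u : TestFn) : L2 →ₗ[ℂ] L2 where
  toFun ψ := (u.memLp_mul ψ).toLp _
  map_add' ψ χ := by
    refine Lp.ext ?_
    filter_upwards [(u.memLp_mul (ψ + χ)).coeFn_toLp, (u.memLp_mul ψ).coeFn_toLp,
      (u.memLp_mul χ).coeFn_toLp, Lp.coeFn_add ψ χ,
      Lp.coeFn_add ((u.memLp_mul ψ).toLp _) ((u.memLp_mul χ).toLp _)] with y h1 h2 h3 h4 h5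
    rw [h1, h5, Pi.add_apply, h2, h3, h4, Pi.add_apply, mul_add]
  map_smul' c ψ := by
    refine Lp.ext ?_
    filter_upwards [(u.memLp_mul (c • ψ)).coeFn_toLp, (u.memLp_mul ψ).coeFn_toLp,
      Lp.coeFn_smul c ψ, Lp.coeFn_smul c ((u.memLp_mul ψ).toLp _)] with y h1 h2 h3 h4
    rw [h1, RingHom.id_apply, h4, Pi.smul_apply, h2, h3, Pi.smul_apply, smul_eq_mul,
      smul_eq_mul, mul_left_comm]

theorem coeFn_mulLin (u : TestFn) (ψ : L2) : mulLin u ψ =ᵐ[volume] fun y => u.1 y * ψ y :=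
  (u.memLp_mul ψ).coeFn_toLp

theorem norm_mulLin_le (u : TestFn) {C : ℝ} (hC : ∀ y, ‖u.1 y‖ ≤ C) (ψ : L2) :
    ‖mulLin u ψ‖ ≤ C * ‖ψ‖ := by
  refine Lp.norm_le_mul_norm_of_ae_le_mul ?_
  filter_upwards [coeFn_mulLin u ψ] with y h1
  rw [h1, norm_mul]
  gcongr
  exact hC y

/-- Multiplication by a test function in `L²`. -/
noncomputable def mulL2 (u : TestFn) : L2 →L[ℂ] L2 :=
  (mulLin u).mkContinuousOfExistsBound
    (u.exists_bound.imp fun _ h ψ => norm_mulLin_le u h.2 ψ)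

theorem coeFn_mulL2 (u : TestFn) (ψ : L2) : mulL2 u ψ =ᵐ[volume] fun y => u.1 y * ψ y :=
  coeFn_mulLin u ψ

theorem norm_mulL2_le (u : TestFn) {C : ℝ} (hC : ∀ y, ‖u.1 y‖ ≤ C) (ψ : L2) :
    ‖mulL2 u ψ‖ ≤ C * ‖ψ‖ := norm_mulLin_le u hC ψ

theorem mulL2_toL2 (u f : TestFn) : mulL2 u (toL2 f) = toL2 (mul u f) := by
  refine Lp.ext ?_
  filter_upwards [coeFn_mulL2 u (toL2 f), coeFn_toL2 f, coeFn_toL2 (mul u f)] with y h1 h2 h3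
  rw [h1, h2, h3, mul_apply]

theorem inner_toL2_mulL2 (u f : TestFn) (ψ : L2) :
    inner ℂ (toL2 f) (mulL2 u ψ) = inner ℂ (toL2 (mul (conj u) f)) ψ := by
  rw [inner_toL2, inner_toL2]
  refine integral_congr_ae ?_
  filter_upwards [coeFn_mulL2 u ψ] with y hy
  rw [hy]
  simp only [mul_apply, conj_apply, map_mul, Complex.conj_conj]
  ring

end TestFn

open TestFn

/-- The graph of the maximal operator in `L²` defined weakly by a formally adjoint operator `L` on
test functions. -/
def weakGraph (L : TestFn →ₗ[ℂ] TestFn) : Submodule ℂ (L2 × L2) where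
  carrier := {z | ∀ f : TestFn, inner ℂ (toL2 f) z.2 = inner ℂ (toL2 (L f)) z.1}
  zero_mem' := by intro f; simp
  add_mem' := by
    intro z w hz hw f
    rw [Prod.snd_add, Prod.fst_add, inner_add_right, inner_add_right, hz, hw]
  smul_mem' := by
    intro c z hz f
    rw [Prod.smul_snd, Prod.smul_fst, inner_smul_right, inner_smul_right, hz]

theorem mem_weakGraph {L : TestFn →ₗ[ℂ] TestFn} {ψ χ : L2} :
    (ψ, χ) ∈ weakGraph L ↔ ∀ f : TestFn, inner ℂ (toL2 f) χ = inner ℂ (toL2 (L f)) ψ :=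
  Iff.rfl

/-- Each test function imposes a closed condition. This identifies the limits of `p φₙ` and `x φₙ`
when the form is shown to be closed. -/
theorem isClosed_weakGraph (L : TestFn →ₗ[ℂ] TestFn) :
    IsClosed (weakGraph L : Set (L2 × L2)) := by
  have : (weakGraph L : Set (L2 × L2)) =
      ⋂ f : TestFn, {z | inner ℂ (toL2 f) z.2 = inner ℂ (toL2 (L f)) z.1} := by
    ext z; simp [weakGraph]
  rw [this]
  exact isClosed_iInter fun f => isClosed_eq (continuous_const.inner continuous_snd)
    (continuous_const.inner continuous_fst)

theorem weakGraph_snd_unique {L : TestFn →ₗ[ℂ] TestFn} {ψ χ χ' : L2}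
    (h : (ψ, χ) ∈ weakGraph L) (h' : (ψ, χ') ∈ weakGraph L) : χ = χ' :=
  eq_of_inner_toL2 fun f => (h f).trans (h' f).symm

theorem momentumGraph_eq (j : Fin 3) : momentumGraph j = weakGraph (p j) := by
  have key : ∀ (g : E3 → ℝ) (hg : ContDiff ℝ ∞ g) (hg' : HasCompactSupport g) (ψ χ : L2),
      (∫ y, g y • χ y = Complex.I * ∫ y, partialDeriv j g y • ψ y) ↔
        inner ℂ (toL2 (ofReal g hg hg')) χ = inner ℂ (toL2 (p j (ofReal g hg hg'))) ψ := by
    intro g hg hg' ψ χ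
    have h1 : ∫ y, g y • χ y = inner ℂ (toL2 (ofReal g hg hg')) χ := by
      rw [inner_toL2]; simp
    have h2 : Complex.I * ∫ y, partialDeriv j g y • ψ y =
        inner ℂ (toL2 (p j (ofReal g hg hg'))) ψ := by
      rw [inner_toL2, ← integral_const_mul]
      refine integral_congr_ae (.of_forall fun y => ?_)
      simp [p_ofReal, mul_assoc]
    rw [h1, h2]
  ext ⟨ψ, χ⟩
  constructor
  · intro h f
    obtain ⟨g₁, h₁, h₁', g₂, h₂, h₂', rfl⟩ := f.eq_ofReal_add
    have e1 := (key g₁ h₁ h₁' ψ χ).1 (h g₁ h₁ h₁')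
    have e2 := (key g₂ h₂ h₂' ψ χ).1 (h g₂ h₂ h₂')
    simp only [map_add, map_smul, inner_add_left, inner_smul_left, e1, e2]
  · exact fun h g hg hg' => (key g hg hg' ψ χ).2 (h _)

theorem positionGraph_eq (j : Fin 3) : positionGraph j = weakGraph (x j) := by
  ext ⟨ψ, χ⟩
  have hint : ∀ f : TestFn, inner ℂ (toL2 (x j f)) ψ =
      ∫ y, (starRingEnd ℂ) (f.1 y) * (y j * ψ y) := fun f => by
    rw [inner_toL2]
    refine integral_congr_ae (.of_forall fun y => ?_)
    simp only [x_apply, map_mul, Complex.conj_ofReal]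
    ring
  constructor
  · intro h f
    rw [hint, inner_toL2]
    refine integral_congr_ae ?_
    filter_upwards [h] with y hy
    rw [hy, Complex.real_smul]
  · intro h
    -- The product `xⱼ ψ` is not yet known to be in `L²`; local integrability suffices to identify
    -- it with `χ`.
    have hloc : LocallyIntegrable (fun y : E3 => y j • ψ y) volume := by
      rw [← locallyIntegrableOn_univ]
      exact LocallyIntegrableOn.continuousOn_smul isOpen_univ.isLocallyClosed
        (((Lp.memLp ψ).locallyIntegrable (by norm_num)).locallyIntegrableOn _)
        (by fun_prop)
    have h0 := ae_eq_of_integral_contDiff_smul_eq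
      ((Lp.memLp χ).locallyIntegrable (by norm_num)) hloc fun g hg hg' => by
        have h1 := h (ofReal g hg hg')
        rw [hint, inner_toL2] at h1
        simpa using h1
    exact h0

/-! ### Mollification -/

/-- The translation `ψ ↦ ψ(· - y)` in `L²`. -/
noncomputable def translate (y : E3) : L2 →ₗᵢ[ℂ] L2 :=
  Lp.compMeasurePreservingₗᵢ ℂ (fun x => x - y) (measurePreserving_sub_right volume y)

theorem continuous_translate (ψ : L2) : Continuous fun y => translate y ψ := by
  let g : E3 → C(E3, E3) := fun y => ⟨fun x => x - y, by fun_prop⟩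
  have hg : Continuous g := ContinuousMap.continuous_of_continuous_uncurry _ (by
    change Continuous fun z : E3 × E3 => z.2 - z.1
    fun_prop)
  exact continuous_const.compMeasurePreservingLp hg
    (fun y => measurePreserving_sub_right volume y) (by norm_num)

theorem translate_toLp (y : E3) {h : E3 → ℂ} (hh : MemLp h 2 volume) :
    translate y (hh.toLp h) =ᵐ[volume] fun x => h (x - y) :=
  (hh.comp_measurePreserving (measurePreserving_sub_right volume y)).coeFn_toLp

/-- The translation `f ↦ f(· - y)` of test functions. -/
def TestFn.translate (y : E3) : TestFn →ₗ[ℂ] TestFn where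
  toFun f := ⟨fun x => f.1 (x - y), f.contDiff.comp (contDiff_id.sub contDiff_const),
    f.hasCompactSupport.comp_homeomorph (Homeomorph.subRight y)⟩
  map_add' _ _ := rfl
  map_smul' _ _ := rfl

@[simp] theorem TestFn.translate_apply (y : E3) (f : TestFn) (z : E3) :
    (TestFn.translate y f).1 z = f.1 (z - y) := rfl

theorem translate_toL2 (y : E3) (f : TestFn) :
    translate y (toL2 f) = toL2 (TestFn.translate y f) :=
  Lp.ext ((translate_toLp y (f.memLp 2)).trans (coeFn_toL2 (TestFn.translate y f)).symm)

theorem inner_toL2_translate (y : E3) (f : TestFn) (ψ : L2) :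
    inner ℂ (toL2 f) (translate y ψ) = inner ℂ (toL2 (TestFn.translate (-y) f)) ψ := by
  have h : f = TestFn.translate y (TestFn.translate (-y) f) := TestFn.ext fun z => by simp
  conv_lhs => rw [h, ← translate_toL2]
  exact (translate y).inner_map_map _ _

theorem TestFn.p_translate (j : Fin 3) (y : E3) (f : TestFn) :
    p j (TestFn.translate y f) = TestFn.translate y (p j f) := by
  refine TestFn.ext fun z => ?_
  rw [TestFn.translate_apply, p_apply, p_apply]
  congr 2
  rw [← fderiv_comp_sub y]; rfl

/-- The average of the translates of `ψ` with respect to a normed bump function. -/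
noncomputable def mollify (φ : ContDiffBump (0 : E3)) (ψ : L2) : L2 :=
  ∫ y, φ.normed volume y • translate y ψ

theorem integrable_mollify (φ : ContDiffBump (0 : E3)) (ψ : L2) :
    Integrable fun y => φ.normed volume y • translate y ψ :=
  (φ.continuous_normed.smul (continuous_translate ψ)).integrable_of_hasCompactSupport
    φ.hasCompactSupport_normed.smul_right

theorem inner_mollify (φ : ContDiffBump (0 : E3)) (χ ψ : L2) :
    inner ℂ χ (mollify φ ψ) = ∫ y, (φ.normed volume y : ℂ) * inner ℂ χ (translate y ψ) := by
  rw [mollify, ← integral_inner (integrable_mollify φ ψ)]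
  refine integral_congr_ae (.of_forall fun y => ?_)
  simp only [inner_smul_right_eq_smul, Complex.real_smul]

theorem tendsto_mollify {φ : ℕ → ContDiffBump (0 : E3)}
    (hφ : Tendsto (fun n => (φ n).rOut) atTop (𝓝 0)) (ψ : L2) :
    Tendsto (fun n => mollify (φ n) ψ) atTop (𝓝 ψ) := by
  -- `mollify` is the convolution of the bump with `y ↦ translate (-y) ψ`, evaluated at `0`; the
  -- sign undoes the reflection in the convolution.
  have h := ContDiffBump.convolution_tendsto_right_of_continuous (μ := (volume : Measure E3)) hφ
    (g := fun y => translate (-y) ψ) ((continuous_translate ψ).comp continuous_neg) 0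
  have h0 : translate 0 ψ = ψ := by
    refine eq_of_inner_toL2 fun f => ?_
    rw [inner_toL2_translate]
    congr 2
    exact TestFn.ext fun z => by simp
  simpa [convolution_def, h0, mollify] using h

/-- If `L` commutes with translations, every translate satisfies the weak equation, and so does
their average. -/
theorem mollify_mem_weakGraph (φ : ContDiffBump (0 : E3)) {L : TestFn →ₗ[ℂ] TestFn}
    (hL : ∀ y f, L (TestFn.translate y f) = TestFn.translate y (L f)) {ψ χ : L2}
    (h : (ψ, χ) ∈ weakGraph L) : (mollify φ ψ, mollify φ χ) ∈ weakGraph L := by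
  intro f
  simp only [inner_mollify, inner_toL2_translate]
  refine integral_congr_ae (.of_forall fun y => ?_)
  simp only
  rw [← hL, mem_weakGraph.1 h]

/-- The vector-valued average agrees, by Fubini, with the pointwise convolution, which is smooth and
whose support grows by at most `φ.rOut`. -/
theorem exists_toL2_eq_mollify (φ : ContDiffBump (0 : E3)) (u : TestFn) {R : ℝ}
    (hu : ∀ y, R ≤ ‖y‖ → u.1 y = 0) (ψ : L2) :
    ∃ f : TestFn, toL2 f = mollify φ (mulL2 u ψ) ∧ ∀ y, R + φ.rOut ≤ ‖y‖ → f.1 y = 0 := by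
  set h : E3 → ℂ := fun y => u.1 y * ψ y with hh
  have hmem : MemLp h 2 volume := u.memLp_mul ψ
  have hint : Integrable h := (u.memLp 2).integrable_mul (Lp.memLp ψ)
  have hsupp : HasCompactSupport h := u.hasCompactSupport.mul_right
  let g : E3 → ℂ :=
    convolution (φ.normed volume) h (ContinuousLinearMap.lsmul ℝ ℝ) volume
  have hg : ContDiff ℝ ∞ g :=
    φ.hasCompactSupport_normed.contDiff_convolution_left _ (n := ⊤) φ.contDiff_normed
      hint.locallyIntegrable
  have hg' : HasCompactSupport g := φ.hasCompactSupport_normed.convolution _ hsupp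
  refine ⟨⟨g, hg, hg'⟩, ?_, fun y hy => ?_⟩
  · refine eq_of_inner_toL2 fun f => ?_
    have e1 : ∀ y, inner ℂ (toL2 f) (translate y (mulL2 u ψ)) =
        ∫ z, (starRingEnd ℂ) (f.1 z) * h (z - y) := fun y => by
      rw [inner_toL2]
      refine integral_congr_ae ?_
      filter_upwards [translate_toLp y hmem] with z hz
      exact congrArg _ hz
    have e2 : inner ℂ (toL2 f) (toL2 ⟨g, hg, hg'⟩) =
        ∫ z, ∫ y, (starRingEnd ℂ) (f.1 z) * (φ.normed volume y • h (z - y)) := by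
      rw [inner_toL2]
      refine integral_congr_ae ?_
      filter_upwards [coeFn_toL2 ⟨g, hg, hg'⟩] with z hz
      rw [hz, integral_const_mul]
      rfl
    rw [e2, inner_mollify, integral_integral_swap]
    · refine integral_congr_ae (.of_forall fun y => ?_)
      simp only
      rw [e1, ← integral_const_mul]
      refine integral_congr_ae (.of_forall fun z => ?_)
      simp only [Complex.real_smul]
      ring
    · obtain ⟨C, -, hC⟩ := f.exists_bound
      have hi := (φ.integrable_normed (μ := volume)).convolution_integrand
        (ContinuousLinearMap.lsmul ℝ ℝ : ℝ →L[ℝ] ℂ →L[ℝ] ℂ) hint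
      refine hi.bdd_mul (c := C) ?_ (.of_forall fun z => ?_)
      · exact ((conj f).continuous.comp continuous_fst).aestronglyMeasurable
      · rw [RCLike.norm_conj]; exact hC _
  · by_contra hne
    have hmem := support_convolution_subset (ContinuousLinearMap.lsmul ℝ ℝ : ℝ →L[ℝ] ℂ →L[ℝ] ℂ)
      (Function.mem_support.2 hne)
    rw [φ.support_normed_eq] at hmem
    obtain ⟨a, ha, b, hb, rfl⟩ := hmem
    have hb' : ‖b‖ < R := by
      by_contra hb'
      exact hb (by simp [hh, hu b (not_lt.1 hb')])
    rw [mem_ball_zero_iff] at ha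
    have := norm_add_le a b
    linarith

/-! ### Cutoffs -/

namespace TestFn

/-- A bump function as a test function. -/
noncomputable def ofBump (φ : ContDiffBump (0 : E3)) : TestFn :=
  ofReal φ φ.contDiff φ.hasCompactSupport

theorem ofBump_apply_eq_one (φ : ContDiffBump (0 : E3)) {y : E3} (hy : ‖y‖ ≤ φ.rIn) :
    (ofBump φ).1 y = 1 := by
  change ((φ y : ℝ) : ℂ) = 1
  rw [φ.one_of_mem_closedBall (by simpa using hy), Complex.ofReal_one]

theorem norm_ofBump_le (φ : ContDiffBump (0 : E3)) (y : E3) : ‖(ofBump φ).1 y‖ ≤ 1 := by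
  change ‖((φ y : ℝ) : ℂ)‖ ≤ 1
  rw [Complex.norm_real, Real.norm_of_nonneg φ.nonneg]
  exact φ.le_one

theorem conj_ofBump (φ : ContDiffBump (0 : E3)) : conj (ofBump φ) = ofBump φ :=
  ext fun y => Complex.conj_ofReal (φ y)

/-- The dilation `f ↦ f(t ·)` of test functions. -/
def dilate {t : ℝ} (ht : t ≠ 0) (f : TestFn) : TestFn :=
  ⟨fun y => f.1 (t • y), f.contDiff.comp (contDiff_const_smul t),
    f.hasCompactSupport.comp_homeomorph (Homeomorph.smulOfNeZero t ht)⟩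

@[simp] theorem dilate_apply {t : ℝ} (ht : t ≠ 0) (f : TestFn) (y : E3) :
    (dilate ht f).1 y = f.1 (t • y) := rfl

theorem p_dilate (j : Fin 3) {t : ℝ} (ht : t ≠ 0) (f : TestFn) :
    p j (dilate ht f) = (t : ℂ) • dilate ht (p j f) := by
  refine ext fun y => ?_
  have h : fderiv ℝ (dilate ht f).1 y = t • fderiv ℝ f.1 (t • y) := fderiv_comp_smul t
  rw [p_apply, h, smul_apply, dilate_apply, p_apply, _root_.smul_apply, Complex.real_smul]
  ring

theorem conj_dilate {t : ℝ} (ht : t ≠ 0) (f : TestFn) :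
    conj (dilate ht f) = dilate ht (conj f) := rfl

theorem mulL2_mulL2 (u w : TestFn) (ψ : L2) : mulL2 u (mulL2 w ψ) = mulL2 (mul u w) ψ := by
  refine Lp.ext ?_
  filter_upwards [coeFn_mulL2 u (mulL2 w ψ), coeFn_mulL2 w ψ, coeFn_mulL2 (mul u w) ψ]
    with y h1 h2 h3
  rw [h1, h2, h3, mul_apply, mul_assoc]

theorem exists_bump (R : ℝ) : ∃ φ : ContDiffBump (0 : E3), R ≤ φ.rIn :=
  ⟨⟨max R 1, max R 1 + 1, by positivity, by linarith⟩, le_max_left _ _⟩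

theorem exists_support_radius (f : TestFn) : ∃ R : ℝ, ∀ y, R ≤ ‖y‖ → f.1 y = 0 := by
  obtain ⟨R, hR⟩ := f.hasCompactSupport.isCompact.isBounded.subset_ball 0
  refine ⟨R, fun y hy => image_eq_zero_of_notMem_tsupport fun hmem => ?_⟩
  have := hR hmem
  rw [mem_ball_zero_iff] at this
  linarith

/-- The cutoff functions `η(· / (n + 1))`. -/
noncomputable def cutoff (φ : ContDiffBump (0 : E3)) (n : ℕ) : TestFn :=
  dilate (t := ((n : ℝ) + 1)⁻¹) (by positivity) (ofBump φ)

theorem cutoff_apply (φ : ContDiffBump (0 : E3)) (n : ℕ) (y : E3) :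
    (cutoff φ n).1 y = (ofBump φ).1 (((n : ℝ) + 1)⁻¹ • y) := rfl

theorem cutoff_mul_eventuallyEq (φ : ContDiffBump (0 : E3)) (f : TestFn) :
    ∀ᶠ n in atTop, mul (cutoff φ n) f = f := by
  obtain ⟨R, hR⟩ := f.exists_support_radius
  obtain ⟨N, hN⟩ := exists_nat_gt (R / φ.rIn)
  filter_upwards [eventually_ge_atTop N] with n hn
  refine ext fun y => ?_
  rw [mul_apply]
  rcases le_or_gt R ‖y‖ with hy | hy
  · rw [hR y hy, mul_zero]
  · rw [cutoff_apply, ofBump_apply_eq_one, one_mul]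
    rw [norm_smul, Real.norm_of_nonneg (by positivity), inv_mul_le_iff₀ (by positivity)]
    rw [div_lt_iff₀ φ.rIn_pos] at hN
    have hn' : (N : ℝ) ≤ n := by exact_mod_cast hn
    have h1 := mul_le_mul_of_nonneg_right hn' φ.rIn_pos.le
    have := φ.rIn_pos
    linarith

theorem conj_cutoff (φ : ContDiffBump (0 : E3)) (n : ℕ) : conj (cutoff φ n) = cutoff φ n := by
  rw [cutoff, conj_dilate, conj_ofBump]

/-- The cutoffs are contractions that eventually fix each test function, and test functions are
dense. -/
theorem tendsto_mulL2_cutoff (φ : ContDiffBump (0 : E3)) (ψ : L2) :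
    Tendsto (fun n => mulL2 (cutoff φ n) ψ) atTop (𝓝 ψ) := by
  rw [Metric.tendsto_atTop]
  intro ε hε
  obtain ⟨_, hf, hfψ⟩ := Metric.mem_closure_iff.1 (dense_testFunctions ψ) (ε / 2) (by positivity)
  obtain ⟨f, rfl⟩ := exists_toL2_eq hf
  obtain ⟨N, hN⟩ := eventually_atTop.1 (cutoff_mul_eventuallyEq φ f)
  refine ⟨N, fun n hn => ?_⟩
  have h2 : ‖mulL2 (cutoff φ n) (ψ - toL2 f)‖ ≤ 1 * ‖ψ - toL2 f‖ :=
    norm_mulL2_le _ (fun y => (cutoff_apply φ n y).symm ▸ norm_ofBump_le φ _) _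
  rw [dist_eq_norm] at hfψ ⊢
  have h3 : mulL2 (cutoff φ n) ψ - ψ = mulL2 (cutoff φ n) (ψ - toL2 f) - (ψ - toL2 f) := by
    rw [map_sub, mulL2_toL2, hN n hn]; abel
  rw [h3]
  refine (norm_sub_le _ _).trans_lt ?_
  linarith

theorem tendsto_mulL2_of_norm_le {u : ℕ → TestFn} {C : ℝ}
    (h : ∀ n y, ‖(u n).1 y‖ ≤ ((n : ℝ) + 1)⁻¹ * C) (ψ : L2) :
    Tendsto (fun n => mulL2 (u n) ψ) atTop (𝓝 0) := by
  refine squeeze_zero_norm (a := fun n : ℕ => ((n : ℝ) + 1)⁻¹ * C * ‖ψ‖)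
    (fun n => norm_mulL2_le _ (h n) _) ?_
  have h0 : Tendsto (fun n : ℕ => ((n : ℝ) + 1)⁻¹) atTop (𝓝 0) := by
    simpa using tendsto_one_div_add_atTop_nhds_zero_nat (𝕜 := ℝ)
  simpa using (h0.mul_const C).mul_const ‖ψ‖

theorem tendsto_mulL2_p_cutoff (φ : ContDiffBump (0 : E3)) (j : Fin 3) (ψ : L2) :
    Tendsto (fun n => mulL2 (p j (cutoff φ n)) ψ) atTop (𝓝 0) := by
  obtain ⟨C, hC0, hC⟩ := (p j (ofBump φ)).exists_bound
  refine tendsto_mulL2_of_norm_le (C := C) (fun n y => ?_) ψ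
  rw [cutoff, p_dilate, smul_apply, norm_mul, Complex.norm_real,
    Real.norm_of_nonneg (by positivity)]
  gcongr
  exact hC _

theorem tendsto_mulL2_p_p_cutoff (φ : ContDiffBump (0 : E3)) (j : Fin 3) (ψ : L2) :
    Tendsto (fun n => mulL2 (p j (p j (cutoff φ n))) ψ) atTop (𝓝 0) := by
  obtain ⟨C, hC0, hC⟩ := (p j (p j (ofBump φ))).exists_bound
  refine tendsto_mulL2_of_norm_le (C := C) (fun n y => ?_) ψ
  rw [cutoff, p_dilate, map_smul, p_dilate, smul_apply, smul_apply, norm_mul, norm_mul,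
    Complex.norm_real, Real.norm_of_nonneg (by positivity)]
  -- The second derivative scales like `(n + 1)⁻²`; one of the two factors is simply bounded by `1`.
  have h1 : ((n : ℝ) + 1)⁻¹ ≤ 1 := inv_le_one_of_one_le₀ (by simp)
  refine mul_le_mul_of_nonneg_left ?_ (by positivity)
  calc _ ≤ 1 * C := by
        gcongr
        exact hC _
    _ = C := one_mul C

/-! ### The oscillator on test functions -/

/-- The operator `p²` on test functions. -/
noncomputable def pSq : TestFn →ₗ[ℂ] TestFn := ∑ j, p j ∘ₗ p j

/-- The operator `x²` on test functions. -/
noncomputable def xSq : TestFn →ₗ[ℂ] TestFn := ∑ j, x j ∘ₗ x j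

/-- The operator `½ (p² + x²)` on test functions. -/
noncomputable def osc : TestFn →ₗ[ℂ] TestFn := (1 / 2 : ℂ) • (pSq + xSq)

theorem pSq_apply (f : TestFn) : pSq f = ∑ j, p j (p j f) := by
  simp [pSq, LinearMap.sum_apply]

theorem xSq_apply (f : TestFn) : xSq f = ∑ j, x j (x j f) := by
  simp [xSq, LinearMap.sum_apply]

theorem osc_apply (f : TestFn) : osc f = (1 / 2 : ℂ) • (pSq f + xSq f) := rfl

theorem xSq_mul (u f : TestFn) : mul (xSq u) f = mul u (xSq f) := by
  refine ext fun y => ?_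
  simp only [xSq_apply, Fin.sum_univ_three, mul_apply, add_apply, x_apply]
  ring

theorem xSq_conj (u : TestFn) : conj (xSq u) = xSq (conj u) := by
  refine ext fun y => ?_
  simp only [xSq_apply, Fin.sum_univ_three, conj_apply, add_apply, x_apply, map_add, map_mul,
    Complex.conj_ofReal]

theorem pSq_translate (y : E3) (f : TestFn) :
    pSq (TestFn.translate y f) = TestFn.translate y (pSq f) := by
  simp only [pSq_apply, map_sum, p_translate]

/-- The derivative in the middle term is kept outside the product, so that in a weak pairing it
falls on `ψ` and no derivative of `f` remains there. -/
theorem osc_mul (u f : TestFn) : osc (mul u f) =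
    mul u (osc f) + ∑ j, p j (mul (p j u) f) - (1 / 2 : ℂ) • ∑ j, mul (p j (p j u)) f := by
  refine ext fun y => ?_
  simp only [osc_apply, pSq_apply, xSq_apply, Fin.sum_univ_three, p_mul, map_add, sub_apply,
    mul_apply, add_apply, smul_apply, x_apply]
  ring

theorem inner_toL2_pSq (f g : TestFn) :
    inner ℂ (toL2 g) (toL2 (pSq f)) = inner ℂ (toL2 (pSq g)) (toL2 f) := by
  simp only [pSq_apply, map_sum, inner_sum, sum_inner]
  exact Finset.sum_congr rfl fun j _ => by rw [inner_toL2_p, inner_toL2_p]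

end TestFn

theorem mulL2_mem_weakGraph_osc {ψ χ : L2} (h : (ψ, χ) ∈ weakGraph osc) {π : Fin 3 → L2}
    (hπ : ∀ j, (ψ, π j) ∈ weakGraph (p j)) {u : TestFn} (hu : conj u = u) :
    (mulL2 u ψ, mulL2 u χ + ∑ j, mulL2 (p j u) (π j) +
      (1 / 2 : ℂ) • ∑ j, mulL2 (p j (p j u)) ψ) ∈ weakGraph osc := by
  intro f
  have h1 : ∀ j, conj (p j u) = -p j u := fun j => by rw [← neg_neg (conj _), ← p_conj, hu]
  have h2 : ∀ j, conj (p j (p j u)) = p j (p j u) := fun j => by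
    rw [← neg_neg (conj _), ← p_conj, h1, map_neg, neg_neg]
  have h3 : ∀ w : TestFn, mul (-w) f = -mul w f := fun w => TestFn.ext fun y => neg_mul _ _
  simp only [inner_add_right, inner_sum, inner_smul_right, inner_toL2_mulL2, hu, h1, h2, h3,
    mem_weakGraph.1 h, mem_weakGraph.1 (hπ _), osc_mul, map_neg, map_add, map_sub, map_sum,
    map_smul, inner_neg_left, inner_add_left, inner_sub_left, sum_inner, inner_smul_left,
    Finset.sum_neg_distrib]
  simp only [map_div₀, map_one, map_ofNat]
  ring

/-- The graph of `½ (p² + x²)` on test functions. -/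
def oscTestGraph : Set (L2 × L2) := Set.range fun f => (toL2 f, toL2 (osc f))

/-- Mollification commutes with `p²` but not with `x²`. On a fixed ball `x²` acts as multiplication
by the test function `xSq η`, which is bounded, so the two parts converge separately. -/
theorem mem_closure_oscTestGraph_of_compact {u : TestFn} {ψ χ : L2}
    (h : (mulL2 u ψ, χ) ∈ weakGraph osc) : (mulL2 u ψ, χ) ∈ closure oscTestGraph := by
  obtain ⟨R, hR⟩ := u.exists_support_radius
  -- Mollifying with radius at most `1` keeps all supports in the ball of radius `R + 1`, where `η =
  -- 1`.
  obtain ⟨b, hb⟩ := exists_bump (R + 1)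
  set η := ofBump b with hη
  let φ : ℕ → ContDiffBump (0 : E3) := fun n =>
    ⟨((n : ℝ) + 1)⁻¹ / 2, ((n : ℝ) + 1)⁻¹, by positivity, half_lt_self (by positivity)⟩
  have hφ : Tendsto (fun n => (φ n).rOut) atTop (𝓝 0) := by
    simpa [φ] using tendsto_one_div_add_atTop_nhds_zero_nat (𝕜 := ℝ)
  have hφ1 : ∀ n, (φ n).rOut ≤ 1 := fun n => inv_le_one_of_one_le₀ (by simp)
  choose f hf hsupp using fun n => exists_toL2_eq_mollify (φ n) u hR ψ
  have hηmul : ∀ g : TestFn, (∀ y, R + 1 ≤ ‖y‖ → g.1 y = 0) → mul (xSq η) g = xSq g := by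
    intro g hg
    rw [xSq_mul]
    refine TestFn.ext fun y => ?_
    rw [mul_apply]
    rcases le_or_gt (R + 1) ‖y‖ with hy | hy
    · simp [xSq_apply, Fin.sum_univ_three, hg y hy]
    · rw [hη, ofBump_apply_eq_one b (hy.le.trans hb), one_mul]
  -- `κ` is the weak `p²` of `u ψ`, obtained by solving `χ = ½ (p² + x²) (u ψ)`.
  set κ := (2 : ℂ) • χ - mulL2 (xSq u) ψ with hκ
  have hκmem : (mulL2 u ψ, κ) ∈ weakGraph pSq := by
    intro g
    have h1 : inner ℂ (toL2 g) (mulL2 (xSq u) ψ) = inner ℂ (toL2 (xSq g)) (mulL2 u ψ) := by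
      rw [inner_toL2_mulL2, xSq_conj, xSq_mul, ← inner_toL2_mulL2]
    have h2 : inner ℂ (toL2 g) χ = inner ℂ (toL2 (osc g)) (mulL2 u ψ) := h g
    change inner ℂ (toL2 g) κ = inner ℂ (toL2 (pSq g)) (mulL2 u ψ)
    rw [hκ, inner_sub_right, inner_smul_right, h1, h2, osc_apply, map_smul, map_add,
      inner_smul_left, inner_add_left]
    simp only [map_div₀, map_one, map_ofNat]
    ring
  have hkin : ∀ n, toL2 (pSq (f n)) = mollify (φ n) κ := fun n => by
    have h1 := mollify_mem_weakGraph (φ n) pSq_translate hκmem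
    rw [← hf] at h1
    exact weakGraph_snd_unique (L := pSq) (fun g => inner_toL2_pSq (f n) g) h1
  have hflim : Tendsto (fun n => toL2 (f n)) atTop (𝓝 (mulL2 u ψ)) :=
    (tendsto_mollify hφ _).congr fun n => (hf n).symm
  have hxlim : Tendsto (fun n => toL2 (xSq (f n))) atTop (𝓝 (mulL2 (xSq u) ψ)) := by
    have h1 := ((mulL2 (xSq η)).continuous.tendsto _).comp hflim
    rw [mulL2_mulL2, hηmul u fun y hy => hR y (by linarith)] at h1
    refine h1.congr fun n => ?_
    rw [Function.comp_apply, mulL2_toL2,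
      hηmul (f n) fun y hy => hsupp n y (by linarith [hφ1 n])]
  have hlim : Tendsto (fun n => toL2 (osc (f n))) atTop (𝓝 χ) := by
    have h1 := ((tendsto_mollify hφ κ).add hxlim).const_smul (1 / 2 : ℂ)
    have h2 : (1 / 2 : ℂ) • (κ + mulL2 (xSq u) ψ) = χ := by
      rw [hκ, sub_add_cancel, smul_smul]
      norm_num
    rw [h2] at h1
    refine h1.congr fun n => ?_
    rw [osc_apply, map_smul, map_add, hkin]
  exact mem_closure_of_tendsto (hflim.prodMk_nhds hlim) (.of_forall fun n => ⟨f n, rfl⟩)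

/-- Cutoffs reduce to compact support. The commutator involves first derivatives of the cutoff
applied to `p ψ` and second ones applied to `ψ`, which vanish in the limit because `p ψ` is in `L²`.
-/
theorem mem_closure_oscTestGraph {ψ χ : L2} (h : (ψ, χ) ∈ weakGraph osc)
    (hπ : ∀ j, ∃ π, (ψ, π) ∈ weakGraph (p j)) : (ψ, χ) ∈ closure oscTestGraph := by
  choose π hπ using hπ
  obtain ⟨φ, -⟩ := exists_bump 1
  have hmem := fun n => mem_closure_oscTestGraph_of_compact
    (mulL2_mem_weakGraph_osc h hπ (conj_cutoff φ n))
  have h1 := ((tendsto_mulL2_cutoff φ χ).add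
    (tendsto_finsetSum Finset.univ fun j _ => tendsto_mulL2_p_cutoff φ j (π j))).add
    ((tendsto_finsetSum Finset.univ fun j _ =>
      tendsto_mulL2_p_p_cutoff φ j ψ).const_smul (1 / 2 : ℂ))
  simp only [Finset.sum_const_zero, smul_zero, add_zero] at h1
  exact isClosed_closure.mem_of_tendsto ((tendsto_mulL2_cutoff φ ψ).prodMk_nhds h1)
    (.of_forall hmem)

/-! ### Bounded multiplication operators -/

theorem norm_mulBounded_le (a : LInf) (ψ : L2) : ‖mulBounded a ψ‖ ≤ ‖a‖ * ‖ψ‖ :=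
  Lp.norm_smul_le a ψ

theorem continuous_mulBounded (a : LInf) : Continuous (mulBounded a) :=
  AddMonoidHomClass.continuous_of_bound (mulBounded a) ‖a‖ (norm_mulBounded_le a)

theorem inner_mulBounded (a : LInf) (φ ψ : L2) :
    inner ℂ (mulBounded a φ) ψ = inner ℂ φ (mulBounded a ψ) := by
  rw [L2.inner_def, L2.inner_def]
  refine integral_congr_ae ?_
  filter_upwards [mulBounded_apply a φ, mulBounded_apply a ψ] with y h1 h2
  rw [h1, h2, Complex.real_smul, Complex.real_smul, RCLike.inner_apply, RCLike.inner_apply,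
    map_mul, Complex.conj_ofReal]
  ring

theorem norm_inner_mulBounded_le (a : LInf) (ψ : L2) :
    ‖inner ℂ ψ (mulBounded a ψ)‖ ≤ ‖a‖ * ‖ψ‖ ^ 2 := by
  refine (norm_inner_le_norm _ _).trans ?_
  nlinarith [mul_le_mul_of_nonneg_left (norm_mulBounded_le a ψ) (norm_nonneg ψ)]

theorem mulBounded_zero : mulBounded 0 = 0 := by
  refine LinearMap.ext fun ψ => ?_
  have := norm_mulBounded_le 0 ψ
  rw [norm_zero, zero_mul] at this
  exact norm_le_zero_iff.1 this

/-! ### The form domain -/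

theorem pOn_mem (j : Fin 3) (φ : formDomain) : ((φ : L2), pOn j φ) ∈ weakGraph (p j) := by
  rw [← momentumGraph_eq]
  exact Submodule.mem_graph_toLinearPMap (momentumGraph_single_valued j)
    (Submodule.inclusion (inf_le_left.trans (iInf_le _ j)) φ)

theorem xOn_mem (j : Fin 3) (φ : formDomain) : ((φ : L2), xOn j φ) ∈ weakGraph (x j) := by
  rw [← positionGraph_eq]
  exact Submodule.mem_graph_toLinearPMap (positionGraph_single_valued j)
    (Submodule.inclusion (inf_le_right.trans (iInf_le _ j)) φ)

theorem mem_formDomain {ψ : L2} (hp : ∀ j, ∃ χ, (ψ, χ) ∈ weakGraph (p j))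
    (hx : ∀ j, ∃ χ, (ψ, χ) ∈ weakGraph (x j)) : ψ ∈ formDomain := by
  simp only [formDomain, Submodule.mem_inf, Submodule.mem_iInf]
  refine ⟨fun j => ?_, fun j => ?_⟩
  · obtain ⟨χ, h⟩ := hp j
    rw [← momentumGraph_eq] at h
    exact ⟨_, h, rfl⟩
  · obtain ⟨χ, h⟩ := hx j
    rw [← positionGraph_eq] at h
    exact ⟨_, h, rfl⟩

theorem toL2_mem_weakGraph_p (j : Fin 3) (f : TestFn) :
    (toL2 f, toL2 (p j f)) ∈ weakGraph (p j) := fun g => inner_toL2_p j f g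

theorem toL2_mem_weakGraph_x (j : Fin 3) (f : TestFn) :
    (toL2 f, toL2 (x j f)) ∈ weakGraph (x j) := by
  rw [← positionGraph_eq]
  change ∀ᵐ y : E3, (toL2 (x j f)) y = y j • (toL2 f) y
  filter_upwards [coeFn_toL2 f, coeFn_toL2 (x j f)] with y h1 h2
  rw [h1, h2, x_apply, Complex.real_smul]

/-- Test functions as elements of the form domain. -/
noncomputable def TestFn.toFormDomain (f : TestFn) : formDomain :=
  ⟨toL2 f, mem_formDomain (fun j => ⟨_, toL2_mem_weakGraph_p j f⟩)
    fun j => ⟨_, toL2_mem_weakGraph_x j f⟩⟩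

@[simp] theorem coe_toFormDomain (f : TestFn) : (f.toFormDomain : L2) = toL2 f := rfl

@[simp] theorem pOn_toFormDomain (j : Fin 3) (f : TestFn) :
    pOn j f.toFormDomain = toL2 (p j f) :=
  weakGraph_snd_unique (pOn_mem j f.toFormDomain) (toL2_mem_weakGraph_p j f)

@[simp] theorem xOn_toFormDomain (j : Fin 3) (f : TestFn) :
    xOn j f.toFormDomain = toL2 (x j f) :=
  weakGraph_snd_unique (xOn_mem j f.toFormDomain) (toL2_mem_weakGraph_x j f)

theorem testFunctions_le_formDomain : testFunctions ≤ formDomain := by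
  intro ψ hψ
  obtain ⟨f, rfl⟩ := exists_toL2_eq hψ
  exact f.toFormDomain.2

theorem dense_formDomain : Dense (formDomain : Set L2) :=
  dense_testFunctions.mono testFunctions_le_formDomain

theorem piOn_apply (a : Fin 3 → LInf) (j : Fin 3) (φ : formDomain) :
    piOn a j φ = pOn j φ - mulBounded (a j) φ := rfl

/-! ### The magnetic form -/

/-- The form of `oscillatorForm`, as a form on `formDomain`. -/
noncomputable def oscForm : formDomain →ₗ⋆[ℂ] formDomain →ₗ[ℂ] ℂ := oscillatorForm.form

/-- The form of `magneticForm`, as a form on `formDomain`. -/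
noncomputable def magForm (a : Fin 3 → LInf) (v : LInf) : formDomain →ₗ⋆[ℂ] formDomain →ₗ[ℂ] ℂ :=
  (magneticForm a v).form

theorem oscForm_apply (φ ψ : formDomain) :
    oscForm φ ψ = 1 / 2 * (∑ j, inner ℂ (pOn j φ) (pOn j ψ)) +
      1 / 2 * ∑ j, inner ℂ (xOn j φ) (xOn j ψ) := oscillatorForm_apply φ ψ

theorem magForm_apply (a : Fin 3 → LInf) (v : LInf) (φ ψ : formDomain) :
    magForm a v φ ψ = 1 / 2 * (∑ j, inner ℂ (piOn a j φ) (piOn a j ψ)) +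
      1 / 2 * (∑ j, inner ℂ (xOn j φ) (xOn j ψ)) + inner ℂ (φ : L2) (mulBounded v ψ) :=
  magneticForm_apply a v φ ψ

/-- The oscillator is the case of zero fields, so the estimates for `magForm` serve both forms. -/
theorem oscForm_eq : oscForm = magForm 0 0 := by
  refine LinearMap.ext fun φ => LinearMap.ext fun ψ => ?_
  rw [oscForm_apply, magForm_apply]
  simp [piOn_apply, mulBounded_zero]

theorem oscillatorForm_eq : oscillatorForm = magneticForm 0 0 :=
  congrArg (SesqForm.mk formDomain) oscForm_eq

theorem mem_operatorGraph_osc {ψ : formDomain} {χ : L2} :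
    ((ψ : L2), χ) ∈ oscillatorForm.operatorGraph ↔
      ∀ φ : formDomain, oscForm φ ψ = inner ℂ (φ : L2) χ := by
  constructor
  · rintro ⟨ψ', hψ', h⟩
    have : ψ' = ψ := Subtype.ext hψ'
    subst this
    exact h
  · exact fun h => ⟨ψ, rfl, h⟩

theorem mem_operatorGraph_mag {a : Fin 3 → LInf} {v : LInf} {ψ : formDomain} {χ : L2} :
    ((ψ : L2), χ) ∈ (magneticForm a v).operatorGraph ↔
      ∀ φ : formDomain, magForm a v φ ψ = inner ℂ (φ : L2) χ := by
  constructor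
  · rintro ⟨ψ', hψ', h⟩
    have : ψ' = ψ := Subtype.ext hψ'
    subst this
    exact h
  · exact fun h => ⟨ψ, rfl, h⟩

theorem magForm_conj (a : Fin 3 → LInf) (v : LInf) (φ ψ : formDomain) :
    (starRingEnd ℂ) (magForm a v ψ φ) = magForm a v φ ψ := by
  rw [magForm_apply, magForm_apply]
  simp only [map_add, map_mul, map_sum, inner_conj_symm, map_div₀, map_one, map_ofNat,
    inner_mulBounded]

theorem isHermitian_magneticForm (a : Fin 3 → LInf) (v : LInf) :
    (magneticForm a v).IsHermitian := fun φ ψ => (magForm_conj a v φ ψ).symm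

theorem re_magForm (a : Fin 3 → LInf) (v : LInf) (φ : formDomain) :
    (magForm a v φ φ).re = 1 / 2 * ∑ j, ‖piOn a j φ‖ ^ 2 +
      1 / 2 * ∑ j, ‖xOn j φ‖ ^ 2 + (inner ℂ (φ : L2) (mulBounded v φ)).re := by
  rw [magForm_apply]
  have key : ∀ t : Fin 3 → ℝ,
      ((1 / 2 : ℂ) * ∑ j, (t j : ℂ) ^ 2).re = 1 / 2 * ∑ j, t j ^ 2 := fun t => by
    rw [show (1 / 2 : ℂ) * ∑ j, (t j : ℂ) ^ 2 = ((1 / 2 * ∑ j, t j ^ 2 : ℝ) : ℂ) by push_cast; rfl,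
      Complex.ofReal_re]
  simp only [inner_self_eq_norm_sq_to_K, Complex.coe_algebraMap]
  rw [Complex.add_re, Complex.add_re, key, key]

/-- Coercivity: the potential costs at most `‖v‖ ‖φ‖²`. The lower bound and closedness both follow
from this. -/
theorem sum_norm_sq_le (a : Fin 3 → LInf) (v : LInf) (φ : formDomain) :
    1 / 2 * ∑ j, ‖piOn a j φ‖ ^ 2 + 1 / 2 * ∑ j, ‖xOn j φ‖ ^ 2 ≤
      (magForm a v φ φ).re + ‖v‖ * ‖(φ : L2)‖ ^ 2 := by
  rw [re_magForm]
  have := (abs_le.1 ((Complex.abs_re_le_norm _).trans (norm_inner_mulBounded_le v φ))).1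
  linarith

theorem magForm_lower_bound (a : Fin 3 → LInf) (v : LInf) (α : ℝ) (φ : formDomain) :
    (α - ‖v‖) * ‖(φ : L2)‖ ^ 2 ≤ (magForm a v φ φ).re + α * ‖(φ : L2)‖ ^ 2 := by
  have h := sum_norm_sq_le a v φ
  have h1 : 0 ≤ 1 / 2 * ∑ j, ‖piOn a j φ‖ ^ 2 + 1 / 2 * ∑ j, ‖xOn j φ‖ ^ 2 := by positivity
  linarith

theorem norm_piOn_sq_le (a : Fin 3 → LInf) (v : LInf) (j : Fin 3) (φ : formDomain) :
    ‖piOn a j φ‖ ^ 2 ≤ 2 * (‖magForm a v φ φ‖ + ‖v‖ * ‖(φ : L2)‖ ^ 2) := by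
  have h := sum_norm_sq_le a v φ
  have h1 : 0 ≤ ∑ j, ‖xOn j φ‖ ^ 2 := by positivity
  have h2 := Finset.single_le_sum (f := fun j => ‖piOn a j φ‖ ^ 2)
    (fun i _ => by positivity) (Finset.mem_univ j)
  have h3 := Complex.re_le_norm (magForm a v φ φ)
  linarith

theorem norm_xOn_sq_le (a : Fin 3 → LInf) (v : LInf) (j : Fin 3) (φ : formDomain) :
    ‖xOn j φ‖ ^ 2 ≤ 2 * (‖magForm a v φ φ‖ + ‖v‖ * ‖(φ : L2)‖ ^ 2) := by
  have h := sum_norm_sq_le a v φ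
  have h1 : 0 ≤ ∑ j, ‖piOn a j φ‖ ^ 2 := by positivity
  have h2 := Finset.single_le_sum (f := fun j => ‖xOn j φ‖ ^ 2)
    (fun i _ => by positivity) (Finset.mem_univ j)
  have h3 := Complex.re_le_norm (magForm a v φ φ)
  linarith

theorem tendsto_magForm_zero (a : Fin 3 → LInf) (v : LInf) {w : ℕ → formDomain}
    (h0 : Tendsto (fun n => (w n : L2)) atTop (𝓝 0))
    (hp : ∀ j, Tendsto (fun n => pOn j (w n)) atTop (𝓝 0))
    (hx : ∀ j, Tendsto (fun n => xOn j (w n)) atTop (𝓝 0)) :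
    Tendsto (fun n => magForm a v (w n) (w n)) atTop (𝓝 0) := by
  have hm : ∀ b : LInf, Tendsto (fun n => mulBounded b (w n)) atTop (𝓝 0) := fun b => by
    simpa [Function.comp_def] using ((continuous_mulBounded b).tendsto 0).comp h0
  have hpi : ∀ j, Tendsto (fun n => piOn a j (w n)) atTop (𝓝 0) := fun j => by
    simpa [piOn_apply] using (hp j).sub (hm (a j))
  have h := (((tendsto_finsetSum Finset.univ fun j _ =>
    (hpi j).inner (𝕜 := ℂ) (hpi j)).const_mul (1 / 2 : ℂ)).add
    ((tendsto_finsetSum Finset.univ fun j _ =>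
      (hx j).inner (𝕜 := ℂ) (hx j)).const_mul (1 / 2 : ℂ))).add (h0.inner (𝕜 := ℂ) (hm v))
  simp only [inner_zero_left, Finset.sum_const_zero, mul_zero, add_zero] at h
  exact h.congr fun n => (magForm_apply a v (w n) (w n)).symm

/-- A linear map on the form domain that is controlled by the form norm maps sequences which are
Cauchy in the form norm to Cauchy sequences. -/
theorem cauchySeq_of_norm_sq_le (a : Fin 3 → LInf) (v : LInf) {A : formDomain →ₗ[ℂ] L2}
    (hA : ∀ φ, ‖A φ‖ ^ 2 ≤ 2 * (‖magForm a v φ φ‖ + ‖v‖ * ‖(φ : L2)‖ ^ 2))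
    {u : ℕ → formDomain} (hu : CauchySeq fun n => (u n : L2))
    (hq : ∀ ε > 0, ∃ N, ∀ m ≥ N, ∀ n ≥ N,
      ‖magForm a v (u m - u n) (u m - u n)‖ < ε) :
    CauchySeq fun n => A (u n) := by
  rw [Metric.cauchySeq_iff]
  intro ε hε
  -- The form and the norm contribute `ε² / 4` each, doubled by the factor `2` in `hA`; the `+ 1`
  -- below covers `‖v‖ = 0`.
  obtain ⟨N₁, hN₁⟩ := hq (ε ^ 2 / 4) (by positivity)
  obtain ⟨N₂, hN₂⟩ := Metric.cauchySeq_iff.1 hu (√(ε ^ 2 / (4 * (‖v‖ + 1)))) (by positivity)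
  refine ⟨max N₁ N₂, fun m hm n hn => ?_⟩
  have h1 := hN₁ m (le_of_max_le_left hm) n (le_of_max_le_left hn)
  have h2 := hN₂ m (le_of_max_le_right hm) n (le_of_max_le_right hn)
  rw [dist_eq_norm] at h2
  have h3 : ‖((u m - u n : formDomain) : L2)‖ ^ 2 < ε ^ 2 / (4 * (‖v‖ + 1)) := by
    have := pow_lt_pow_left₀ h2 (norm_nonneg _) two_ne_zero
    rwa [Real.sq_sqrt (by positivity)] at this
  rw [lt_div_iff₀ (by positivity)] at h3
  rw [dist_eq_norm, ← map_sub]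
  refine lt_of_pow_lt_pow_left₀ 2 hε.le ((hA _).trans_lt ?_)
  have h4 : 0 ≤ ‖((u m - u n : formDomain) : L2)‖ ^ 2 := by positivity
  nlinarith

theorem exists_limit_of_magForm (a : Fin 3 → LInf) (v : LInf) (u : ℕ → formDomain) (ψ : L2)
    (hu : Tendsto (fun n => (u n : L2)) atTop (𝓝 ψ))
    (hq : ∀ ε > 0, ∃ N, ∀ m ≥ N, ∀ n ≥ N, ‖magForm a v (u m - u n) (u m - u n)‖ < ε) :
    ∃ φ : formDomain, (φ : L2) = ψ ∧
      Tendsto (fun n => magForm a v (u n - φ) (u n - φ)) atTop (𝓝 0) := by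
  have hpi : ∀ j, ∃ χ, Tendsto (fun n => piOn a j (u n)) atTop (𝓝 χ) := fun j =>
    cauchySeq_tendsto_of_complete
      (cauchySeq_of_norm_sq_le a v (norm_piOn_sq_le a v j) hu.cauchySeq hq)
  -- The form controls `π`, and `p = π + a` with `a` bounded.
  have hp : ∀ j, ∃ χ, Tendsto (fun n => pOn j (u n)) atTop (𝓝 χ) := fun j => by
    obtain ⟨χ, hχ⟩ := hpi j
    refine ⟨_, (hχ.add (((continuous_mulBounded (a j)).tendsto _).comp hu)).congr fun n => ?_⟩
    exact sub_add_cancel (pOn j (u n)) (mulBounded (a j) (u n))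
  have hx : ∀ j, ∃ χ, Tendsto (fun n => xOn j (u n)) atTop (𝓝 χ) := fun j =>
    cauchySeq_tendsto_of_complete
      (cauchySeq_of_norm_sq_le a v (norm_xOn_sq_le a v j) hu.cauchySeq hq)
  choose P hP using hp
  choose X hX using hx
  have hPmem : ∀ j, (ψ, P j) ∈ weakGraph (p j) := fun j =>
    (isClosed_weakGraph _).mem_of_tendsto (hu.prodMk_nhds (hP j)) (.of_forall fun n => pOn_mem j _)
  have hXmem : ∀ j, (ψ, X j) ∈ weakGraph (x j) := fun j =>
    (isClosed_weakGraph _).mem_of_tendsto (hu.prodMk_nhds (hX j)) (.of_forall fun n => xOn_mem j _)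
  let φ : formDomain := ⟨ψ, mem_formDomain (fun j => ⟨_, hPmem j⟩) fun j => ⟨_, hXmem j⟩⟩
  have hpφ : ∀ j, pOn j φ = P j := fun j => weakGraph_snd_unique (pOn_mem j φ) (hPmem j)
  have hxφ : ∀ j, xOn j φ = X j := fun j => weakGraph_snd_unique (xOn_mem j φ) (hXmem j)
  refine ⟨φ, rfl, tendsto_magForm_zero a v (w := fun n => u n - φ) ?_ (fun j => ?_)
    fun j => ?_⟩
  · simpa using hu.sub_const ψ
  · simpa [hpφ] using (hP j).sub_const (P j)
  · simpa [hxφ] using (hX j).sub_const (X j)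

theorem isClosed_magneticForm (a : Fin 3 → LInf) (v : LInf) : (magneticForm a v).IsClosed :=
  exists_limit_of_magForm a v

/-! ### Approximation by test functions -/

theorem oscForm_toFormDomain (f : TestFn) (ψ : formDomain) :
    oscForm f.toFormDomain ψ = inner ℂ (toL2 (osc f)) (ψ : L2) := by
  rw [oscForm_apply]
  simp only [pOn_toFormDomain, xOn_toFormDomain, mem_weakGraph.1 (pOn_mem _ ψ),
    mem_weakGraph.1 (xOn_mem _ ψ), osc_apply, pSq_apply, xSq_apply, map_smul, map_add, map_sum,
    inner_smul_left, inner_add_left, sum_inner, map_div₀, map_one, map_ofNat]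
  ring

theorem mem_weakGraph_osc {ψ χ : L2} (h : (ψ, χ) ∈ oscillatorForm.operatorGraph) :
    (ψ, χ) ∈ weakGraph osc := by
  obtain ⟨ψ', rfl, h⟩ := h
  intro f
  exact (h f.toFormDomain).symm.trans (oscForm_toFormDomain f ψ')

theorem toL2_mem_operatorGraph (f : TestFn) :
    (toL2 f, toL2 (osc f)) ∈ oscillatorForm.operatorGraph := by
  refine (mem_operatorGraph_osc (ψ := f.toFormDomain)).2 fun φ => ?_
  rw [oscForm_eq, ← magForm_conj, ← oscForm_eq, oscForm_toFormDomain, inner_conj_symm]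

theorem tendsto_of_oscForm {w : ℕ → formDomain}
    (h0 : Tendsto (fun n => (w n : L2)) atTop (𝓝 0))
    (h : Tendsto (fun n => oscForm (w n) (w n)) atTop (𝓝 0)) :
    (∀ j, Tendsto (fun n => pOn j (w n)) atTop (𝓝 0)) ∧
      ∀ j, Tendsto (fun n => xOn j (w n)) atTop (𝓝 0) := by
  have key : ∀ A : formDomain →ₗ[ℂ] L2, (∀ φ, ‖A φ‖ ^ 2 ≤
      2 * (‖magForm 0 0 φ φ‖ + ‖(0 : LInf)‖ * ‖(φ : L2)‖ ^ 2)) →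
      Tendsto (fun n => A (w n)) atTop (𝓝 0) := by
    intro A hA
    rw [oscForm_eq] at h
    have h1 : Tendsto (fun n => ‖A (w n)‖ ^ 2) atTop (𝓝 0) :=
      squeeze_zero (fun n => by positivity) (fun n => hA (w n))
        (by simpa using (h.norm.add ((h0.norm.pow 2).const_mul ‖(0 : LInf)‖)).const_mul 2)
    rw [tendsto_zero_iff_norm_tendsto_zero]
    simpa [Function.comp_def, Real.sqrt_sq] using (Real.continuous_sqrt.tendsto _).comp h1
  refine ⟨fun j => key _ fun φ => ?_, fun j => key _ (norm_xOn_sq_le 0 0 j)⟩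
  have := norm_piOn_sq_le 0 0 j φ
  rwa [piOn_apply, Pi.zero_apply, mulBounded_zero, LinearMap.zero_apply, sub_zero] at this

/-- Graph convergence gives convergence of `p` and `x` for free, since `q₀(w, w) = ⟪w, h₀ w⟫` for
`w` in the operator domain. -/
theorem exists_operator_approx {ψ : formDomain} {χ : L2}
    (h : ((ψ : L2), χ) ∈ oscillatorForm.operatorGraph) :
    ∃ f : ℕ → TestFn, Tendsto (fun n => toL2 (f n)) atTop (𝓝 (ψ : L2)) ∧
      Tendsto (fun n => toL2 (osc (f n))) atTop (𝓝 χ) ∧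
      (∀ j, Tendsto (fun n => toL2 (p j (f n))) atTop (𝓝 (pOn j ψ))) ∧
      ∀ j, Tendsto (fun n => toL2 (x j (f n))) atTop (𝓝 (xOn j ψ)) := by
  obtain ⟨z, hz, hlim⟩ := mem_closure_iff_seq_limit.1
    (mem_closure_oscTestGraph (mem_weakGraph_osc h) fun j => ⟨_, pOn_mem j ψ⟩)
  choose f hf using hz
  obtain ⟨h1, h2⟩ := Prod.tendsto_iff _ _ |>.1 hlim
  simp only [← hf] at h1 h2
  have hw : Tendsto (fun n => (((f n).toFormDomain - ψ : formDomain) : L2)) atTop (𝓝 0) := by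
    simpa using h1.sub_const (ψ : L2)
  have hq : Tendsto (fun n => oscForm ((f n).toFormDomain - ψ)
      ((f n).toFormDomain - ψ)) atTop (𝓝 0) := by
    have h3 := hw.inner (𝕜 := ℂ) (h2.sub_const χ)
    rw [inner_zero_left] at h3
    refine h3.congr fun n => ?_
    exact (mem_operatorGraph_osc.1
      (oscillatorForm.operatorGraph.sub_mem (toL2_mem_operatorGraph (f n)) h) _).symm
  obtain ⟨h3, h4⟩ := tendsto_of_oscForm hw hq
  refine ⟨f, h1, h2, fun j => ?_, fun j => ?_⟩
  · simpa using (h3 j).add_const (pOn j ψ)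
  · simpa using (h4 j).add_const (xOn j ψ)

theorem exists_operatorDomain_approx (φ : formDomain) :
    ∃ u : ℕ → formDomain, (∀ n, ∃ χ, ((u n : L2), χ) ∈ oscillatorForm.operatorGraph) ∧
      Tendsto (fun n => (u n : L2)) atTop (𝓝 (φ : L2)) ∧
      Tendsto (fun n => oscForm (u n - φ) (u n - φ)) atTop (𝓝 0) := by
  obtain ⟨-, -, -, -, h⟩ := (magneticForm 0 0).exists_resolvent
    (isHermitian_magneticForm 0 0) (isClosed_magneticForm 0 0) dense_formDomain
    (α := 1) (m := 1 - ‖(0 : LInf)‖) (by simp) (magForm_lower_bound 0 0 1)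
  rw [oscillatorForm_eq, oscForm_eq]
  exact h φ

/-- Two density statements are composed: `D(h₀)` is dense in the form norm, and test functions are
dense in `D(h₀)`. The map `Θ` records `φ`, `p φ`, `x φ`, so that both become closures in one metric
space. -/
theorem exists_form_approx (φ : formDomain) :
    ∃ f : ℕ → TestFn, Tendsto (fun n => toL2 (f n)) atTop (𝓝 (φ : L2)) ∧
      (∀ j, Tendsto (fun n => toL2 (p j (f n))) atTop (𝓝 (pOn j φ))) ∧
      ∀ j, Tendsto (fun n => toL2 (x j (f n))) atTop (𝓝 (xOn j φ)) := by
  let Θ : formDomain → L2 × (Fin 3 → L2) × (Fin 3 → L2) := fun φ =>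
    ((φ : L2), fun j => pOn j φ, fun j => xOn j φ)
  have hΘ : ∀ {u : ℕ → formDomain} {φ : formDomain},
      Tendsto (fun n => Θ (u n)) atTop (𝓝 (Θ φ)) ↔
        Tendsto (fun n => (u n : L2)) atTop (𝓝 (φ : L2)) ∧
        (∀ j, Tendsto (fun n => pOn j (u n)) atTop (𝓝 (pOn j φ))) ∧
        ∀ j, Tendsto (fun n => xOn j (u n)) atTop (𝓝 (xOn j φ)) := by
    intro u φ
    rw [Prod.tendsto_iff, Prod.tendsto_iff, tendsto_pi_nhds, tendsto_pi_nhds]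
  have hop : ∀ (ψ : formDomain) (χ : L2), ((ψ : L2), χ) ∈ oscillatorForm.operatorGraph →
      Θ ψ ∈ closure (Set.range fun f : TestFn => Θ f.toFormDomain) := by
    intro ψ χ h
    obtain ⟨f, h1, -, h2, h3⟩ := exists_operator_approx h
    refine mem_closure_of_tendsto (hΘ.2 ⟨h1, fun j => ?_, fun j => ?_⟩)
      (.of_forall fun n => ⟨f n, rfl⟩)
    · simpa using h2 j
    · simpa using h3 j
  have hφ : Θ φ ∈ closure (Set.range fun f : TestFn => Θ f.toFormDomain) := by
    obtain ⟨u, hu, hlim, hq⟩ := exists_operatorDomain_approx φ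
    have hw : Tendsto (fun n => ((u n - φ : formDomain) : L2)) atTop (𝓝 0) := by
      simpa using hlim.sub_const (φ : L2)
    obtain ⟨h1, h2⟩ := tendsto_of_oscForm hw hq
    refine isClosed_closure.mem_of_tendsto (hΘ.2 ⟨hlim, fun j => ?_, fun j => ?_⟩)
      (.of_forall fun n => hop (u n) _ (hu n).choose_spec)
    · have := (h1 j).add_const (pOn j φ)
      simpa only [map_sub, sub_add_cancel, zero_add] using this
    · have := (h2 j).add_const (xOn j φ)
      simpa only [map_sub, sub_add_cancel, zero_add] using this
  obtain ⟨z, hz, hlim⟩ := mem_closure_iff_seq_limit.1 hφ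
  choose f hf using hz
  obtain rfl : z = fun n => Θ (f n).toFormDomain := funext fun n => (hf n).symm
  have := (hΘ (u := fun n => (f n).toFormDomain)).1 hlim
  exact ⟨f, this.1, by simpa using this.2.1, by simpa using this.2.2⟩

theorem exists_testFn_tendsto_magForm (a : Fin 3 → LInf) (v : LInf) (φ : formDomain) :
    ∃ u : ℕ → formDomain, (∀ n, (u n : L2) ∈ testFunctions) ∧
      Tendsto (fun n => (u n : L2)) atTop (𝓝 (φ : L2)) ∧
      Tendsto (fun n => magForm a v (u n - φ) (u n - φ)) atTop (𝓝 0) := by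
  obtain ⟨f, h1, h2, h3⟩ := exists_form_approx φ
  refine ⟨fun n => (f n).toFormDomain, fun n => toL2_mem (f n), h1,
    tendsto_magForm_zero a v (w := fun n => (f n).toFormDomain - φ) ?_ (fun j => ?_)
    fun j => ?_⟩
  · simpa using h1.sub_const (φ : L2)
  · simpa using (h2 j).sub_const (pOn j φ)
  · simpa using (h3 j).sub_const (xOn j φ)

theorem isFormCore_testFunctions (a : Fin 3 → LInf) (v : LInf) :
    (magneticForm a v).IsFormCore testFunctions :=
  ⟨testFunctions_le_formDomain, exists_testFn_tendsto_magForm a v⟩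

/-! ### Vector potentials with bounded divergence -/

theorem integrable_mul_testFn (a : LInf) (w : TestFn) :
    Integrable fun y => (a y : ℂ) * w.1 y := by
  have h := memLp_one_iff_integrable.1 (((w.memLp 1).smul (Lp.memLp a) : MemLp _ 1 volume))
  exact h.congr (.of_forall fun y => Complex.real_smul)

theorem inner_toL2_mulBounded (a : LInf) (f g : TestFn) :
    inner ℂ (toL2 f) (mulBounded a (toL2 g)) = ∫ y, (a y : ℂ) * (mul (conj f) g).1 y := by
  rw [inner_toL2]
  refine integral_congr_ae ?_
  filter_upwards [mulBounded_apply a (toL2 g), coeFn_toL2 g] with y h1 h2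
  rw [h1, h2, Complex.real_smul, mul_apply, conj_apply]
  ring

/-- The function `d` is the distributional divergence of `a`. -/
def IsDivergence (a : Fin 3 → LInf) (d : LInf) : Prop :=
  ∀ g : E3 → ℝ, ContDiff ℝ ∞ g → HasCompactSupport g →
    ∫ x, ∑ j, a j x * partialDeriv j g x = -∫ x, d x * g x

theorem IsDivergence.sum_integral_p {a : Fin 3 → LInf} {d : LInf} (h : IsDivergence a d)
    (w : TestFn) :
    ∑ j, ∫ y, (a j y : ℂ) * (p j w).1 y = Complex.I * ∫ y, (d y : ℂ) * w.1 y := by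
  have hreal : ∀ g hg hg', ∑ j, ∫ y, (a j y : ℂ) * (p j (ofReal g hg hg')).1 y =
      Complex.I * ∫ y, (d y : ℂ) * (ofReal g hg hg').1 y := by
    intro g hg hg'
    rw [← integral_finsetSum _ fun j _ => integrable_mul_testFn (a j) _]
    have h1 : ∀ y, ∑ j, (a j y : ℂ) * (p j (ofReal g hg hg')).1 y =
        -Complex.I * ((∑ j, a j y * partialDeriv j g y : ℝ) : ℂ) := fun y => by
      rw [Complex.ofReal_sum, Finset.mul_sum]
      refine Finset.sum_congr rfl fun j _ => ?_
      rw [p_ofReal, Complex.ofReal_mul]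
      ring
    have h2 : ∀ y, (d y : ℂ) * (ofReal g hg hg').1 y = ((d y * g y : ℝ) : ℂ) := fun y => by
      rw [Complex.ofReal_mul]; rfl
    simp_rw [h1, h2]
    rw [integral_const_mul, integral_complex_ofReal, integral_complex_ofReal, h g hg hg']
    push_cast
    ring
  obtain ⟨g₁, h₁, h₁', g₂, h₂, h₂', rfl⟩ := w.eq_ofReal_add
  have hlin : ∀ (b : LInf) (w₁ w₂ : TestFn), ∫ y, (b y : ℂ) * (w₁ + Complex.I • w₂).1 y =
      (∫ y, (b y : ℂ) * w₁.1 y) + Complex.I * ∫ y, (b y : ℂ) * w₂.1 y := by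
    intro b w₁ w₂
    rw [← integral_const_mul, ← integral_add (integrable_mul_testFn b w₁)
      ((integrable_mul_testFn b w₂).const_mul _)]
    refine integral_congr_ae (.of_forall fun y => ?_)
    simp only [TestFn.add_apply, TestFn.smul_apply]
    ring
  simp only [map_add, map_smul, hlin, Finset.sum_add_distrib, ← Finset.mul_sum, hreal]
  ring

/-- The divergence identity is tested on `conj f * g`; the product rule for `p` splits it into the
three terms. -/
theorem IsDivergence.sum_inner_toL2 {a : Fin 3 → LInf} {d : LInf} (h : IsDivergence a d)
    (f g : TestFn) :
    ∑ j, inner ℂ (toL2 (p j f)) (mulBounded (a j) (toL2 g)) =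
      ∑ j, inner ℂ (toL2 f) (mulBounded (a j) (toL2 (p j g))) -
        Complex.I * inner ℂ (toL2 f) (mulBounded d (toL2 g)) := by
  simp only [inner_toL2_mulBounded]
  rw [← h.sum_integral_p, ← Finset.sum_sub_distrib]
  refine Finset.sum_congr rfl fun j _ => ?_
  rw [← integral_sub (integrable_mul_testFn _ _) (integrable_mul_testFn _ _)]
  refine integral_congr_ae (.of_forall fun y => ?_)
  have h1 : conj (p j f) = -p j (conj f) := by rw [p_conj, neg_neg]
  simp only [h1, p_mul, mul_apply, TestFn.add_apply]
  change (a j y : ℂ) * (-(p j (conj f)).1 y * g.1 y) = _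
  ring

theorem IsDivergence.sum_inner_pOn {a : Fin 3 → LInf} {d : LInf} (h : IsDivergence a d)
    (φ ψ : formDomain) :
    ∑ j, inner ℂ (pOn j φ) (mulBounded (a j) ψ) =
      ∑ j, inner ℂ (φ : L2) (mulBounded (a j) (pOn j ψ)) -
        Complex.I * inner ℂ (φ : L2) (mulBounded d ψ) := by
  obtain ⟨f, hf, hpf, -⟩ := exists_form_approx φ
  obtain ⟨g, hg, hpg, -⟩ := exists_form_approx ψ
  have hm : ∀ (b : LInf) {u : ℕ → L2} {χ : L2}, Tendsto u atTop (𝓝 χ) →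
      Tendsto (fun n => mulBounded b (u n)) atTop (𝓝 (mulBounded b χ)) :=
    fun b u χ hu => ((continuous_mulBounded b).tendsto χ).comp hu
  have h1 := tendsto_finsetSum Finset.univ fun j _ => (hpf j).inner (𝕜 := ℂ) (hm (a j) hg)
  have h2 := (tendsto_finsetSum Finset.univ fun j _ =>
    hf.inner (𝕜 := ℂ) (hm (a j) (hpg j))).sub ((hf.inner (𝕜 := ℂ) (hm d hg)).const_mul Complex.I)
  exact tendsto_nhds_unique h1 (h2.congr fun n => (h.sum_inner_toL2 (f n) (g n)).symm)

/-- The first order operator `-a·p + ½ a² + ½ i (∇·a) + v` on the form domain. -/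
noncomputable def perturbation (a : Fin 3 → LInf) (v d : LInf) : formDomain →ₗ[ℂ] L2 :=
  (1 / 2 : ℂ) • (∑ j, mulBounded (a j) ∘ₗ mulBounded (a j)) ∘ₗ formDomain.subtype -
    ∑ j, mulBounded (a j) ∘ₗ pOn j + (Complex.I / 2) • mulBounded d ∘ₗ formDomain.subtype +
    mulBounded v ∘ₗ formDomain.subtype

theorem perturbation_apply (a : Fin 3 → LInf) (v d : LInf) (ψ : formDomain) :
    perturbation a v d ψ = (1 / 2 : ℂ) • ∑ j, mulBounded (a j) (mulBounded (a j) ψ) -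
      ∑ j, mulBounded (a j) (pOn j ψ) + (Complex.I / 2) • mulBounded d ψ + mulBounded v ψ := by
  simp [perturbation, LinearMap.sum_apply]

/-- In the expanded square, commuting `p` past `a` merges the two cross terms into `-a·p` and leaves
`½ i d`. -/
theorem IsDivergence.magForm_eq {a : Fin 3 → LInf} {d : LInf} (h : IsDivergence a d) (v : LInf)
    (φ ψ : formDomain) :
    magForm a v φ ψ = oscForm φ ψ + inner ℂ (φ : L2) (perturbation a v d ψ) := by
  have h1 := h.sum_inner_pOn φ ψ
  rw [magForm_apply, oscForm_apply, perturbation_apply]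
  simp only [piOn_apply, inner_sub_left, inner_sub_right, inner_add_right, inner_smul_right,
    inner_sum, Finset.sum_sub_distrib, inner_mulBounded] at h1 ⊢
  rw [h1]
  ring

/-- The perturbation maps the whole form domain into `L²`, so it can be moved to the right-hand
side; no relative bound is needed for the domains to agree. -/
theorem IsDivergence.mem_operatorGraph_iff {a : Fin 3 → LInf} {d : LInf} (h : IsDivergence a d)
    (v : LInf) {ψ : formDomain} {χ : L2} :
    ((ψ : L2), χ) ∈ (magneticForm a v).operatorGraph ↔
      ((ψ : L2), χ - perturbation a v d ψ) ∈ oscillatorForm.operatorGraph := by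
  rw [mem_operatorGraph_mag, mem_operatorGraph_osc]
  refine forall_congr' fun φ => ?_
  rw [h.magForm_eq, inner_sub_right, eq_sub_iff_add_eq]

theorem IsDivergence.exists_operator_approx {a : Fin 3 → LInf} {d : LInf} (h : IsDivergence a d)
    (v : LInf) {ψ : formDomain} {χ : L2}
    (hψ : ((ψ : L2), χ) ∈ (magneticForm a v).operatorGraph) :
    ∃ (f : ℕ → TestFn) (u : ℕ → L2),
      (∀ n, (toL2 (f n), u n) ∈ (magneticForm a v).operatorGraph) ∧
      Tendsto (fun n => toL2 (f n)) atTop (𝓝 (ψ : L2)) ∧ Tendsto u atTop (𝓝 χ) := by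
  obtain ⟨f, h1, h2, h3, -⟩ := MagneticOscillator.exists_operator_approx
    ((h.mem_operatorGraph_iff v).1 hψ)
  refine ⟨f, fun n => toL2 (osc (f n)) + perturbation a v d (f n).toFormDomain, fun n => ?_,
    h1, ?_⟩
  · refine (h.mem_operatorGraph_iff v (ψ := (f n).toFormDomain)).2 ?_
    rw [add_sub_cancel_right]
    exact toL2_mem_operatorGraph (f n)
  · have hm : ∀ (b : LInf) {u : ℕ → L2} {χ : L2}, Tendsto u atTop (𝓝 χ) →
        Tendsto (fun n => mulBounded b (u n)) atTop (𝓝 (mulBounded b χ)) :=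
      fun b u χ hu => ((continuous_mulBounded b).tendsto χ).comp hu
    -- The perturbation is of first order, so convergence of `f n` and `p (f n)` is enough.
    have h4 : Tendsto (fun n => perturbation a v d (f n).toFormDomain) atTop
        (𝓝 (perturbation a v d ψ)) := by
      simp only [perturbation_apply, coe_toFormDomain, pOn_toFormDomain]
      exact ((((tendsto_finsetSum _ fun j _ => hm (a j) (hm (a j) h1)).const_smul _).sub
        (tendsto_finsetSum _ fun j _ => hm (a j) (h3 j))).add ((hm d h1).const_smul _)).add
        (hm v h1)
    simpa using h2.add h4

/-! ### The Hamiltonians -/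

theorem SesqForm.graph_operator {H : Type*} [NormedAddCommGroup H] [InnerProductSpace ℂ H]
    {q : SesqForm H} (hq : Dense (q.domain : Set H)) : q.operator.graph = q.operatorGraph :=
  Submodule.toLinearPMap_graph_eq _ (q.operatorGraph_single_valued hq)

theorem SesqForm.represents_operator {H : Type*} [NormedAddCommGroup H] [InnerProductSpace ℂ H]
    {q : SesqForm H} (hq : Dense (q.domain : Set H)) : q.Represents q.operator := by
  have hle : q.operator.domain ≤ q.domain := by
    rintro _ ⟨z, ⟨ψ, hψ, -⟩, rfl⟩
    exact (congrArg (· ∈ q.domain) hψ).mp ψ.2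
  refine ⟨hle, fun φ ψ => ?_⟩
  have h := q.operator.mem_graph ψ
  rw [graph_operator hq] at h
  obtain ⟨ψ', hψ', h⟩ := h
  have h1 : Submodule.inclusion hle ψ = ψ' := Subtype.ext hψ'.symm
  rw [h1, h φ]

theorem SesqForm.Represents.le_operator {H : Type*} [NormedAddCommGroup H]
    [InnerProductSpace ℂ H] {q : SesqForm H} (hq : Dense (q.domain : Set H)) {T : H →ₗ.[ℂ] H}
    (hT : q.Represents T) : T ≤ q.operator := by
  obtain ⟨hle, h⟩ := hT
  refine LinearPMap.le_of_le_graph ?_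
  rw [graph_operator hq]
  rintro ⟨ψ, χ⟩ hz
  obtain ⟨y, rfl, rfl⟩ := exists_eq_of_mem_graph hz
  exact ⟨Submodule.inclusion hle y, rfl, fun φ => h φ y⟩

theorem SesqForm.isSelfAdjoint_operator {H : Type*} [NormedAddCommGroup H]
    [InnerProductSpace ℂ H] [CompleteSpace H] {q : SesqForm H} (hq : q.IsHermitian)
    (hclosed : q.IsClosed) (hdense : Dense (q.domain : Set H)) {α m : ℝ} (hm : 0 < m)
    (hpos : ∀ φ : q.domain, m * ‖(φ : H)‖ ^ 2 ≤ (q.form φ φ).re + α * ‖(φ : H)‖ ^ 2) :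
    IsSelfAdjoint q.operator := by
  obtain ⟨G, hG, hgraph, -⟩ := q.exists_resolvent hq hclosed hdense hm hpos
  rw [← graph_operator hdense] at hgraph
  exact isSelfAdjoint_of_mem_graph_iff
    ((ContinuousLinearMap.nonneg_iff_isPositive _).1 hG).isSelfAdjoint _ hgraph

/-- The second representation theorem: a positive shift of the operator determined by a closed form
has a unique positive square root, whose domain is the form domain. -/
theorem SesqForm.isPositiveSqrt_shift_operator {H : Type*} [NormedAddCommGroup H]
    [InnerProductSpace ℂ H] [CompleteSpace H] {q : SesqForm H} (hq : q.IsHermitian)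
    (hclosed : q.IsClosed) (hdense : Dense (q.domain : Set H)) {α m : ℝ} (hm : 0 < m)
    (hpos : ∀ φ : q.domain, m * ‖(φ : H)‖ ^ 2 ≤ (q.form φ φ).re + α * ‖(φ : H)‖ ^ 2) :
    (∃! S : H →ₗ.[ℂ] H, IsPositiveSqrt S (shift q.operator α)) ∧
      ∀ S : H →ₗ.[ℂ] H, IsPositiveSqrt S (shift q.operator α) → S.domain = q.domain := by
  obtain ⟨G, hG, hgraph, hrange, -⟩ := q.exists_resolvent hq hclosed hdense hm hpos
  have hA : ∀ ψ χ, (ψ, χ) ∈ (shift q.operator α).graph ↔ G χ = ψ := fun ψ χ => by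
    rw [mem_graph_shift, graph_operator hdense, hgraph, sub_add_cancel]
  refine ⟨existsUnique_isPositiveSqrt hG hA, fun S hS => ?_⟩
  have h := (isPositiveSqrt_iff hG hA S).1 hS
  refine SetLike.coe_injective ?_
  rw [← hrange]
  ext ψ
  constructor
  · exact fun hψ => ⟨S ⟨ψ, hψ⟩, (h _ _).1 (S.mem_graph ⟨ψ, hψ⟩)⟩
  · rintro ⟨χ, hχ⟩
    obtain ⟨y, rfl, -⟩ := exists_eq_of_mem_graph ((h _ _).2 hχ)
    exact y.2

theorem graph_hamiltonian (a : Fin 3 → LInf) (v : LInf) :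
    (hamiltonian a v).graph = (magneticForm a v).operatorGraph :=
  SesqForm.graph_operator dense_formDomain

theorem isSelfAdjoint_hamiltonian (a : Fin 3 → LInf) (v : LInf) :
    IsSelfAdjoint (hamiltonian a v) :=
  SesqForm.isSelfAdjoint_operator (isHermitian_magneticForm a v) (isClosed_magneticForm a v)
    dense_formDomain (sub_pos.2 (lt_add_one ‖v‖)) (magForm_lower_bound a v _)

theorem shift_hamiltonian_pos (a : Fin 3 → LInf) (v : LInf) {α : ℝ} (hα : ‖v‖ < α)
    (ψ : (shift (hamiltonian a v) α).domain) (hψ : (ψ : L2) ≠ 0) :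
    0 < (inner ℂ (ψ : L2) (shift (hamiltonian a v) α ψ)).re := by
  have h := (shift (hamiltonian a v) α).mem_graph ψ
  rw [mem_graph_shift, graph_hamiltonian] at h
  obtain ⟨φ, hφ, -⟩ := id h
  rw [← show (φ : L2) = ψ from hφ] at h hψ ⊢
  have h1 := mem_operatorGraph_mag.1 h φ
  rw [inner_sub_right, inner_smul_right, inner_self_eq_norm_sq_to_K, eq_sub_iff_add_eq] at h1
  rw [← h1]
  have h2 := magForm_lower_bound a v α φ
  have h3 : 0 < ‖(φ : L2)‖ ^ 2 := by positivity
  have h4 := mul_pos (sub_pos.2 hα) h3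
  have h5 : (magForm a v φ φ + (α : ℂ) * ((‖(φ : L2)‖ : ℝ) : ℂ) ^ 2).re =
      (magForm a v φ φ).re + α * ‖(φ : L2)‖ ^ 2 := by
    simp [← Complex.ofReal_pow]
  exact (h4.trans_le h2).trans_eq h5.symm

theorem IsDivergence.domain_hamiltonian {a : Fin 3 → LInf} {d : LInf} (h : IsDivergence a d)
    (v : LInf) : (hamiltonian a v).domain = oscillatorHamiltonian.domain := by
  ext ψ
  constructor
  · rintro ⟨⟨_, χ⟩, hz, rfl⟩
    obtain ⟨φ, rfl, -⟩ := id hz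
    exact ⟨_, (h.mem_operatorGraph_iff v).1 hz, rfl⟩
  · rintro ⟨⟨_, χ⟩, hz, rfl⟩
    obtain ⟨φ, rfl, -⟩ := id hz
    exact ⟨((φ : L2), χ + perturbation a v d φ), (h.mem_operatorGraph_iff v (ψ := φ)).2
      (by rw [add_sub_cancel_right]; exact hz), rfl⟩

theorem IsDivergence.isEssentiallySelfAdjointOn {a : Fin 3 → LInf} {d : LInf}
    (h : IsDivergence a d) (v : LInf) :
    IsEssentiallySelfAdjointOn (hamiltonian a v) testFunctions := by
  have hsa := isSelfAdjoint_hamiltonian a v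
  have hle : (hamiltonian a v).domRestrict testFunctions ≤ hamiltonian a v :=
    LinearPMap.domRestrict_le
  have hclosable := hsa.isClosed.isClosable.leIsClosable hle
  refine ⟨fun ψ hψ => ?_, hclosable, ?_⟩
  · obtain ⟨f, rfl⟩ := exists_toL2_eq hψ
    rw [h.domain_hamiltonian]
    exact ⟨_, toL2_mem_operatorGraph f, rfl⟩
  -- One inclusion holds because `h` is closed; the other is approximation by test functions in the
  -- graph of `h`.
  · suffices hcl : ((hamiltonian a v).domRestrict testFunctions).closure = hamiltonian a v by
      rwa [hcl]
    refine LinearPMap.eq_of_eq_graph ?_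
    rw [← hclosable.graph_closure_eq_closure_graph]
    refine le_antisymm (Submodule.topologicalClosure_minimal _
      (LinearPMap.le_graph_of_le hle) hsa.isClosed) ?_
    rintro ⟨ψ, χ⟩ hz
    rw [graph_hamiltonian] at hz
    obtain ⟨φ, rfl, -⟩ := id hz
    obtain ⟨f, u, hmem, hf, hu⟩ := h.exists_operator_approx v hz
    refine mem_closure_of_tendsto (hf.prodMk_nhds hu) (.of_forall fun n => ?_)
    have hn := hmem n
    rw [← graph_hamiltonian] at hn
    obtain ⟨y, hy, hy'⟩ := exists_eq_of_mem_graph hn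
    have hyC : (y : L2) ∈ testFunctions := hy ▸ toL2_mem (f n)
    rw [← hy, ← hy']
    have h1 := ((hamiltonian a v).domRestrict testFunctions).mem_graph ⟨y, hyC, y.2⟩
    have h2 : (hamiltonian a v).domRestrict testFunctions ⟨y, hyC, y.2⟩ = hamiltonian a v y :=
      LinearPMap.domRestrict_apply rfl
    rw [h2] at h1
    exact h1

end MagneticOscillator

theorem proposition3p1 (a : Fin 3 → LInf) (v : LInf) :
    ((magneticForm a v).IsHermitian ∧
      Dense ((magneticForm a v).domain : Set L2) ∧
      (magneticForm a v).IsBoundedBelow ∧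
      (magneticForm a v).IsClosed) ∧
    (IsSelfAdjoint (hamiltonian a v) ∧
      (magneticForm a v).Represents (hamiltonian a v) ∧
      ∀ T : L2 →ₗ.[ℂ] L2, IsSelfAdjoint T → (magneticForm a v).Represents T →
        T = hamiltonian a v) ∧
    (magneticForm a v).IsFormCore testFunctions ∧
    (∀ α : ℝ, ‖v‖ < α →
      (∀ ψ : (shift (hamiltonian a v) α).domain, (ψ : L2) ≠ 0 →
        0 < (inner ℂ (ψ : L2) (shift (hamiltonian a v) α ψ)).re) ∧
      (∃! S : L2 →ₗ.[ℂ] L2, IsPositiveSqrt S (shift (hamiltonian a v) α)) ∧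
      ∀ S : L2 →ₗ.[ℂ] L2, IsPositiveSqrt S (shift (hamiltonian a v) α) →
        S.domain = oscillatorForm.domain) ∧
    (HasBoundedDivergence a →
      (hamiltonian a v).domain = oscillatorHamiltonian.domain ∧
      IsEssentiallySelfAdjointOn (hamiltonian a v) testFunctions) := by
  refine ⟨⟨isHermitian_magneticForm a v, dense_formDomain,
    ⟨-‖v‖, fun φ => ?_⟩, isClosed_magneticForm a v⟩,
    ⟨isSelfAdjoint_hamiltonian a v, SesqForm.represents_operator dense_formDomain,
      fun T hT hrep => eq_of_le_of_isSelfAdjoint hT (isSelfAdjoint_hamiltonian a v)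
        (hrep.le_operator dense_formDomain)⟩,
    isFormCore_testFunctions a v,
    fun α hα => ⟨shift_hamiltonian_pos a v hα, SesqForm.isPositiveSqrt_shift_operator
      (isHermitian_magneticForm a v) (isClosed_magneticForm a v) dense_formDomain
      (sub_pos.2 hα) (magForm_lower_bound a v α)⟩, ?_⟩
  · have := magForm_lower_bound a v 0 φ
    rwa [zero_sub, zero_mul, add_zero] at this
  · rintro ⟨d, hd⟩
    exact ⟨IsDivergence.domain_hamiltonian hd v, IsDivergence.isEssentiallySelfAdjointOn hd v⟩
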